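/- Let $\mathfrak V$ be the complex Virasoro algebra, with basis $\{\mathtt c,\mathtt l_i : i\in\mathbb Z\}$ and Lie bracket $[\mathtt l_i,\mathtt l_j]=(j-i)\mathtt l_{i+j}+\delta_{i,-j}\frac{i^3-i}{12}\mathtt c$, $[\mathtt l_i,\mathtt c]=0$. Let $\mathfrak n$ be the Lie subalgebra spanned by the $\mathtt l_i$ with $i\ge 1$, and let $\mathfrak b$ be the Lie subalgebra generated by $\mathfrak n$ and $\mathtt l_0$. Let $z\in\mathbb C$ be nonzero and let $\mathfrak a_z\subseteq\mathfrak n$ be the Lie subalgebra spanned by the elements $\mathtt l_k-z^{k-1}\mathtt l_1$ with $k\ge 2$. For $\mathbf m=(m_2,m_3,m_4)\in\mathbb C^3$ let $\mathbb C_{\mathbf m}$ be the one-dimensional $\mathfrak a_z$-module on which $\mathtt l_k-z^{k-1}\mathtt l_1$ acts by the scalar $m_k$ for every $k\geq 2$, where $m_k:=-(k-4)m_3z^{k-3}+(k-3)m_4z^{k-4}$ for $k>4$. Put $V_{\mathbf m}=\mathrm{Ind}_{\mathfrak a_z}^{\mathfrak n}\mathbb C_{\mathbf m}=U(\mathfrak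 n)\otimes_{U(\mathfrak a_z)}\mathbb C_{\mathbf m}$ and $W_{\mathbf m}=\mathrm{Ind}_{\mathfrak n}^{\mathfrak b}V_{\mathbf m}=U(\mathfrak b)\otimes_{U(\mathfrak n)}V_{\mathbf m}$. If $zm_3\neq m_4$ and $(m_2,m_3,m_4)\neq(m_2,2zm_2,3z^2m_2)$, then $W_{\mathbf m}$ is a simple $\mathfrak b$-module. -/

import Mathlib

noncomputable section

open scoped TensorProduct

/-! ### The Virasoro algebra -/

/-- The underlying vector space of the complex Virasoro algebra: the complex vector space with
basis indexed by `Option ℤ`, where `some i` indexes `l i` and `none` indexes the central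
element `c`. -/
def Virasoro : Type := Option ℤ →₀ ℂ

namespace Virasoro

instance instAddCommGroup : AddCommGroup Virasoro :=
  inferInstanceAs (AddCommGroup (Option ℤ →₀ ℂ))

instance instModule : Module ℂ Virasoro :=
  inferInstanceAs (Module ℂ (Option ℤ →₀ ℂ))

/-- The standard basis of the Virasoro algebra. -/
def basis : Module.Basis (Option ℤ) ℂ Virasoro := Module.Basis.ofRepr (LinearEquiv.refl ℂ _)

/-- The basis element `l i`, for `i : ℤ`. -/
def l (i : ℤ) : Virasoro := basis (some i)

/-- The central basis element `c`. -/
def c : Virasoro := basis none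

/-- The bracket on basis elements:
`[l i, l j] = (j - i) l (i + j) + δ_{i,-j} ((i ^ 3 - i) / 12) c`, and `c` is central. -/
def basisBracket : Option ℤ → Option ℤ → Virasoro
  | some i, some j =>
      ((j : ℂ) - (i : ℂ)) • l (i + j) + (if i = -j then ((i : ℂ) ^ 3 - (i : ℂ)) / 12 else 0) • c
  | _, _ => 0

/-- The bracket, as the bilinear extension of `basisBracket`. -/
def bracketBilin : Virasoro →ₗ[ℂ] Virasoro →ₗ[ℂ] Virasoro :=
  basis.constr ℂ fun a => basis.constr ℂ fun b => basisBracket a b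

theorem induction_basis {p : Virasoro → Prop} (hb : ∀ a, p (basis a)) (h0 : p 0)
    (hadd : ∀ u v, p u → p v → p (u + v)) (hsmul : ∀ (t : ℂ) (u), p u → p (t • u))
    (x : Virasoro) : p x :=
  Submodule.span_induction (p := fun x _ => p x) (by rintro _ ⟨a, rfl⟩; exact hb a) h0
    (fun u v _ _ => hadd u v) (fun t u _ => hsmul t u) (basis.mem_span x)

theorem bracketBilin_basis (a b : Option ℤ) :
    bracketBilin (basis a) (basis b) = basisBracket a b := by
  simp [bracketBilin, Module.Basis.constr_basis]

theorem bracketBilin_l_l (i j : ℤ) :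
    bracketBilin (l i) (l j) = ((j : ℂ) - (i : ℂ)) • l (i + j) +
      (if i = -j then ((i : ℂ) ^ 3 - (i : ℂ)) / 12 else 0) • c :=
  bracketBilin_basis _ _

theorem bracketBilin_c_left (x : Virasoro) : bracketBilin c x = 0 := by
  have : bracketBilin c = 0 := basis.ext fun b => by
    rw [c, bracketBilin_basis]; rfl
  rw [this, LinearMap.zero_apply]

theorem bracketBilin_swap (x y : Virasoro) : bracketBilin y x = -bracketBilin x y := by
  have : bracketBilin.flip = -bracketBilin := by
    refine basis.ext fun a => basis.ext fun b => ?_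
    rw [LinearMap.flip_apply, LinearMap.neg_apply, LinearMap.neg_apply, bracketBilin_basis,
      bracketBilin_basis]
    rcases a with _ | i <;> rcases b with _ | j <;> simp only [basisBracket, neg_zero]
    rw [add_comm j i]
    by_cases h : i = -j
    · have h' : j = -i := by omega
      rw [if_pos h, if_pos h', h']
      push_cast
      module
    · have h' : j ≠ -i := by omega
      rw [if_neg h, if_neg h']
      module
  have h2 := LinearMap.congr_fun (LinearMap.congr_fun this x) y
  simpa using h2

theorem bracketBilin_c_right (x : Virasoro) : bracketBilin x c = 0 := by
  rw [bracketBilin_swap, bracketBilin_c_left, neg_zero]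

theorem bracketBilin_leibniz (x y w : Virasoro) :
    bracketBilin x (bracketBilin y w) =
      bracketBilin (bracketBilin x y) w + bracketBilin y (bracketBilin x w) := by
  have key : ∀ a b d : Option ℤ,
      bracketBilin (basis a) (bracketBilin (basis b) (basis d)) =
        bracketBilin (bracketBilin (basis a) (basis b)) (basis d) +
          bracketBilin (basis b) (bracketBilin (basis a) (basis d)) := by
    have hcb : basis none = c := rfl
    have hlb (i : ℤ) : basis (some i) = l i := rfl
    intro a b d
    rcases a with _ | i
    · simp only [hcb, bracketBilin_c_left, map_zero, LinearMap.zero_apply,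
        add_zero]
    rcases b with _ | j
    · simp only [hcb, bracketBilin_c_left, bracketBilin_c_right, map_zero, LinearMap.zero_apply,
        add_zero]
    rcases d with _ | k
    · simp only [hcb, bracketBilin_c_right, map_zero, add_zero]
    simp only [hlb, bracketBilin_l_l, map_add, map_smul, LinearMap.add_apply,
      LinearMap.smul_apply, bracketBilin_c_left, bracketBilin_c_right, smul_zero, add_zero]
    have e1 : i + j + k = i + (j + k) := by ring
    have e2 : j + (i + k) = i + (j + k) := by ring
    rw [e1, e2]
    by_cases h : i + (j + k) = 0
    · have h1 : i = -(j + k) := by omega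
      have h2 : i + j = -k := by omega
      have h3 : j = -(i + k) := by omega
      rw [if_pos h1, if_pos h2, if_pos h3]
      have hk : k = -(i + j) := by omega
      rw [hk]
      push_cast
      module
    · have h1 : i ≠ -(j + k) := by omega
      have h2 : i + j ≠ -k := by omega
      have h3 : j ≠ -(i + k) := by omega
      rw [if_neg h1, if_neg h2, if_neg h3]
      push_cast
      module
  induction w using induction_basis with
  | h0 => simp only [map_zero, add_zero]
  | hadd u v hu hv => simp only [map_add, hu, hv]; abel
  | hsmul t u hu => simp only [map_smul, hu, smul_add]
  | hb d =>
    induction y using induction_basis with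
    | h0 => simp only [map_zero, LinearMap.zero_apply, add_zero]
    | hadd u v hu hv => simp only [map_add, LinearMap.add_apply, hu, hv]; abel
    | hsmul t u hu => simp only [map_smul, LinearMap.smul_apply, hu, smul_add]
    | hb b =>
      induction x using induction_basis with
      | h0 => simp only [map_zero, LinearMap.zero_apply, add_zero]
      | hadd u v hu hv => simp only [map_add, LinearMap.add_apply, hu, hv]; abel
      | hsmul t u hu => simp only [map_smul, LinearMap.smul_apply, hu, smul_add]
      | hb a => exact key a b d

instance instBracket : Bracket Virasoro Virasoro := ⟨fun x y => bracketBilin x y⟩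

instance instLieRing : LieRing Virasoro where
  add_lie x y w := by
    change bracketBilin (x + y) w = bracketBilin x w + bracketBilin y w
    rw [map_add, LinearMap.add_apply]
  lie_add x y w := map_add (bracketBilin x) y w
  lie_self x := by
    change bracketBilin x x = 0
    have h : (2 : ℂ) • bracketBilin x x = 0 := by
      rw [two_smul]
      nth_rewrite 1 [bracketBilin_swap]
      exact neg_add_cancel _
    exact (smul_eq_zero.mp h).resolve_left two_ne_zero
  leibniz_lie x y w := bracketBilin_leibniz x y w

instance instLieAlgebra : LieAlgebra ℂ Virasoro where
  lie_smul t x y := map_smul (bracketBilin x) t y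

theorem lie_l_l (i j : ℤ) :
    ⁅l i, l j⁆ = ((j : ℂ) - (i : ℂ)) • l (i + j) +
      (if i = -j then ((i : ℂ) ^ 3 - (i : ℂ)) / 12 else 0) • c :=
  bracketBilin_l_l i j

theorem lie_l_c (i : ℤ) : ⁅l i, c⁆ = 0 := bracketBilin_c_right _

/-! ### The subalgebras `𝔫`, `𝔟` and `𝔞_z` -/

/-- The positive part `𝔫`: the Lie subalgebra with underlying space the linear span of the
elements `l i` with `i ≥ 1`. -/
def positivePart : LieSubalgebra ℂ Virasoro where
  toSubmodule := Submodule.span ℂ {x | ∃ i : ℤ, 1 ≤ i ∧ x = l i}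
  lie_mem' := by
    intro x y hx hy
    change bracketBilin x y ∈ Submodule.span ℂ {x | ∃ i : ℤ, 1 ≤ i ∧ x = l i}
    induction hx, hy using Submodule.span_induction₂ with
    | mem_mem x y hx hy =>
      obtain ⟨i, hi, rfl⟩ := hx
      obtain ⟨j, hj, rfl⟩ := hy
      rw [bracketBilin_l_l, if_neg (by omega), zero_smul, add_zero]
      exact Submodule.smul_mem _ _ (Submodule.subset_span ⟨i + j, by omega, rfl⟩)
    | zero_left y hy => simp
    | zero_right x hx => simp
    | add_left x y w _ _ _ h1 h2 => rw [map_add, LinearMap.add_apply]; exact add_mem h1 h2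
    | add_right x y w _ _ _ h1 h2 => rw [map_add]; exact add_mem h1 h2
    | smul_left t x y _ _ h =>
      rw [map_smul, LinearMap.smul_apply]; exact Submodule.smul_mem _ _ h
    | smul_right t x y _ _ h => rw [map_smul]; exact Submodule.smul_mem _ _ h

/-- The standard Borel subalgebra `𝔟`: the Lie subalgebra generated by `𝔫` and `l 0`. -/
def borel : LieSubalgebra ℂ Virasoro :=
  LieSubalgebra.lieSpan ℂ Virasoro (insert (l 0) (positivePart : Set Virasoro))

theorem positivePart_le_borel : positivePart ≤ borel := fun _ hx =>
  LieSubalgebra.subset_lieSpan (Set.mem_insert_of_mem _ hx)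

/-- The elements `l k - z ^ (k - 1) l 1` (meant for `k ≥ 2`). -/
def lHat (z : ℂ) (k : ℕ) : Virasoro := l k - z ^ (k - 1) • l 1

theorem bracketBilin_lHat (z : ℂ) {i j : ℕ} (hi : 2 ≤ i) (hj : 2 ≤ j) :
    bracketBilin (lHat z i) (lHat z j) =
      ((j : ℂ) - i) • lHat z (i + j) - (((j : ℂ) - 1) * z ^ (i - 1)) • lHat z (j + 1)
        + (((i : ℂ) - 1) * z ^ (j - 1)) • lHat z (i + 1) := by
  obtain ⟨i, rfl⟩ : ∃ i', i = i' + 2 := ⟨i - 2, by omega⟩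
  obtain ⟨j, rfl⟩ : ∃ j', j = j' + 2 := ⟨j - 2, by omega⟩
  simp only [lHat, map_sub, map_smul, LinearMap.sub_apply, LinearMap.smul_apply,
    bracketBilin_l_l]
  rw [if_neg (by push_cast; omega), if_neg (by push_cast; omega), if_neg (by push_cast; omega),
    if_neg (by omega)]
  have e1 : (1 : ℤ) + ((j + 2 : ℕ) : ℤ) = ((j + 2 + 1 : ℕ) : ℤ) := by push_cast; ring
  have e2 : ((i + 2 : ℕ) : ℤ) + 1 = ((i + 2 + 1 : ℕ) : ℤ) := by push_cast; ring
  have e3 : ((i + 2 : ℕ) : ℤ) + ((j + 2 : ℕ) : ℤ) = ((i + 2 + (j + 2) : ℕ) : ℤ) := by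
    push_cast; ring
  rw [e1, e2, e3]
  have p1 : i + 2 - 1 = i + 1 := by omega
  have p2 : j + 2 - 1 = j + 1 := by omega
  have p3 : i + 2 + (j + 2) - 1 = i + j + 3 := by omega
  have p4 : i + 2 + 1 - 1 = i + 2 := by omega
  have p5 : j + 2 + 1 - 1 = j + 2 := by omega
  rw [p1, p2, p3, p4, p5]
  push_cast
  module

/-- The subalgebra `𝔞_z`, with underlying space the linear span of the elements
`l k - z ^ (k - 1) l 1`, where `k ≥ 2`. -/
def aSub (z : ℂ) : LieSubalgebra ℂ Virasoro where
  toSubmodule := Submodule.span ℂ {x | ∃ k : ℕ, 2 ≤ k ∧ x = lHat z k}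
  lie_mem' := by
    intro x y hx hy
    change bracketBilin x y ∈ Submodule.span ℂ {x | ∃ k : ℕ, 2 ≤ k ∧ x = lHat z k}
    induction hx, hy using Submodule.span_induction₂ with
    | mem_mem x y hx hy =>
      obtain ⟨i, hi, rfl⟩ := hx
      obtain ⟨j, hj, rfl⟩ := hy
      rw [bracketBilin_lHat z hi hj]
      exact add_mem (sub_mem
        (Submodule.smul_mem _ _ (Submodule.subset_span ⟨i + j, by omega, rfl⟩))
        (Submodule.smul_mem _ _ (Submodule.subset_span ⟨j + 1, by omega, rfl⟩)))
        (Submodule.smul_mem _ _ (Submodule.subset_span ⟨i + 1, by omega, rfl⟩))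
    | zero_left y hy => simp
    | zero_right x hx => simp
    | add_left x y w _ _ _ h1 h2 => rw [map_add, LinearMap.add_apply]; exact add_mem h1 h2
    | add_right x y w _ _ _ h1 h2 => rw [map_add]; exact add_mem h1 h2
    | smul_left t x y _ _ h =>
      rw [map_smul, LinearMap.smul_apply]; exact Submodule.smul_mem _ _ h
    | smul_right t x y _ _ h => rw [map_smul]; exact Submodule.smul_mem _ _ h

theorem lHat_mem_aSub (z : ℂ) {k : ℕ} (hk : 2 ≤ k) : lHat z k ∈ aSub z :=
  Submodule.subset_span ⟨k, hk, rfl⟩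

theorem aSub_le_positivePart (z : ℂ) : aSub z ≤ positivePart := by
  intro x hx
  have : Submodule.span ℂ {x | ∃ k : ℕ, 2 ≤ k ∧ x = lHat z k} ≤
      Submodule.span ℂ {x | ∃ i : ℤ, 1 ≤ i ∧ x = l i} := by
    refine Submodule.span_le.mpr ?_
    rintro _ ⟨k, hk, rfl⟩
    exact sub_mem (Submodule.subset_span ⟨k, by omega, rfl⟩)
      (Submodule.smul_mem _ _ (Submodule.subset_span ⟨1, le_refl _, rfl⟩))
  exact this hx

end Virasoro

/-! ### Induced modules of Lie algebras -/

section Induction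

attribute [local instance 100] LieRing.ofAssociativeRing

variable {R : Type*} [CommRing R]
  {H : Type*} [LieRing H] [LieAlgebra R H] {G : Type*} [LieRing G] [LieAlgebra R G]

/-- The algebra homomorphism `U(H) → U(G)` induced by a homomorphism `f : H → G` of Lie algebras. -/
def envelopingMap (f : H →ₗ⁅R⁆ G) :
    UniversalEnvelopingAlgebra R H →ₐ[R] UniversalEnvelopingAlgebra R G :=
  UniversalEnvelopingAlgebra.lift R ((UniversalEnvelopingAlgebra.ι R).comp f)

theorem envelopingMap_ι (f : H →ₗ⁅R⁆ G) (x : H) :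
    envelopingMap f (UniversalEnvelopingAlgebra.ι R x) = UniversalEnvelopingAlgebra.ι R (f x) :=
  UniversalEnvelopingAlgebra.lift_ι_apply' R _ x

variable (V : Type*) [AddCommGroup V] [Module R V] [LieRingModule H V] [LieModule R H V]

/-- The action of `U(H)` on an `H`-module `V`, as an algebra homomorphism `U(H) → End V`. -/
def envelopingAction : UniversalEnvelopingAlgebra R H →ₐ[R] Module.End R V :=
  UniversalEnvelopingAlgebra.lift R (LieModule.toEnd R H V)

theorem envelopingAction_ι (x : H) (v : V) :
    envelopingAction V (UniversalEnvelopingAlgebra.ι R x) v = ⁅x, v⁆ := by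
  have h : envelopingAction V (UniversalEnvelopingAlgebra.ι R x) = LieModule.toEnd R H V x :=
    UniversalEnvelopingAlgebra.lift_ι_apply' R _ x
  rw [h, LieModule.toEnd_apply_apply]

/-- The `U(G)`-submodule of `U(G) ⊗[R] V` generated by the balancing relations over `U(H)`. -/
def balancedRelations (f : H →ₗ⁅R⁆ G) :
    Submodule (UniversalEnvelopingAlgebra R G) (UniversalEnvelopingAlgebra R G ⊗[R] V) :=
  Submodule.span _ {t | ∃ (u : UniversalEnvelopingAlgebra R G)
    (a : UniversalEnvelopingAlgebra R H) (v : V),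
    t = (u * envelopingMap f a) ⊗ₜ[R] v - u ⊗ₜ[R] envelopingAction V a v}

/-- The module `U(G) ⊗_{U(H)} V` induced from the `H`-module `V` along a homomorphism
`f : H → G` of Lie algebras. -/
def InducedModule (f : H →ₗ⁅R⁆ G) : Type _ :=
  (UniversalEnvelopingAlgebra R G ⊗[R] V) ⧸ balancedRelations V f

namespace InducedModule

variable (f : H →ₗ⁅R⁆ G)

instance : AddCommGroup (InducedModule V f) :=
  inferInstanceAs (AddCommGroup ((UniversalEnvelopingAlgebra R G ⊗[R] V) ⧸ balancedRelations V f))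

instance : Module (UniversalEnvelopingAlgebra R G) (InducedModule V f) :=
  inferInstanceAs (Module (UniversalEnvelopingAlgebra R G)
    ((UniversalEnvelopingAlgebra R G ⊗[R] V) ⧸ balancedRelations V f))

instance : Module R (InducedModule V f) :=
  inferInstanceAs (Module R ((UniversalEnvelopingAlgebra R G ⊗[R] V) ⧸ balancedRelations V f))

instance : IsScalarTower R (UniversalEnvelopingAlgebra R G) (InducedModule V f) :=
  inferInstanceAs (IsScalarTower R (UniversalEnvelopingAlgebra R G)
    ((UniversalEnvelopingAlgebra R G ⊗[R] V) ⧸ balancedRelations V f))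

/-- The Lie algebra `G` acts through `G → U(G)`. -/
instance : LieRingModule G (InducedModule V f) where
  bracket x w := UniversalEnvelopingAlgebra.ι R x • w
  add_lie x y w := by
    change UniversalEnvelopingAlgebra.ι R (x + y) • w = _ • w + _ • w
    rw [map_add, add_smul]
  lie_add x v w := smul_add _ v w
  leibniz_lie x y w := by
    change UniversalEnvelopingAlgebra.ι R x • UniversalEnvelopingAlgebra.ι R y • w =
      UniversalEnvelopingAlgebra.ι R ⁅x, y⁆ • w +
        UniversalEnvelopingAlgebra.ι R y • UniversalEnvelopingAlgebra.ι R x • w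
    rw [LieHom.map_lie, LieRing.of_associative_ring_bracket, sub_smul, mul_smul, mul_smul,
      sub_add_cancel]

theorem lie_def (x : G) (w : InducedModule V f) :
    ⁅x, w⁆ = UniversalEnvelopingAlgebra.ι R x • w := rfl

instance : LieModule R G (InducedModule V f) where
  smul_lie t x w := by rw [lie_def, lie_def, map_smul, smul_assoc]
  lie_smul t x w := by rw [lie_def, lie_def, smul_algebra_smul_comm]

/-- The class of the elementary tensor `u ⊗ v`. -/
def tmul (u : UniversalEnvelopingAlgebra R G) (v : V) : InducedModule V f :=
  (balancedRelations V f).mkQ (u ⊗ₜ[R] v)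

theorem lie_tmul (x : G) (u : UniversalEnvelopingAlgebra R G) (v : V) :
    ⁅x, tmul V f u v⁆ = tmul V f (UniversalEnvelopingAlgebra.ι R x * u) v := rfl

theorem tmul_balanced (u : UniversalEnvelopingAlgebra R G) (a : UniversalEnvelopingAlgebra R H)
    (v : V) : tmul V f (u * envelopingMap f a) v = tmul V f u (envelopingAction V a v) :=
  (Submodule.Quotient.eq _).mpr (Submodule.subset_span ⟨u, a, v, rfl⟩)

end InducedModule

end Induction

/-! ### The modules `ℂ_𝐦`, `V_𝐦` and `W_𝐦` -/

namespace Virasoro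

/-- The scalars `m_k` by which `l k - z ^ (k - 1) l 1` acts on `ℂ_𝐦`: they are the given numbers
for `k = 2, 3, 4`, and `- (k - 4) m₃ z ^ (k - 3) + (k - 3) m₄ z ^ (k - 4)` for `k > 4`.
The value `0` for `k < 2` is not used. -/
def mCoeff (z m₂ m₃ m₄ : ℂ) (k : ℕ) : ℂ :=
  if k < 2 then 0
  else if k = 2 then m₂
  else if k = 3 then m₃
  else if k = 4 then m₄
  else -((k : ℂ) - 4) * m₃ * z ^ (k - 3) + ((k : ℂ) - 3) * m₄ * z ^ (k - 4)

/-- The linear form on the Virasoro algebra with `l k ↦ m_k` for `k ≥ 2` and all other basis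
elements sent to `0`. Only its restriction to `𝔞_z` is used. -/
def mForm (z m₂ m₃ m₄ : ℂ) : Virasoro →ₗ[ℂ] ℂ :=
  basis.constr ℂ fun a => a.elim 0 fun i => mCoeff z m₂ m₃ m₄ i.toNat

theorem mForm_lHat (z m₂ m₃ m₄ : ℂ) (k : ℕ) :
    mForm z m₂ m₃ m₄ (lHat z k) = mCoeff z m₂ m₃ m₄ k := by
  have h (i : ℤ) : mForm z m₂ m₃ m₄ (l i) = mCoeff z m₂ m₃ m₄ i.toNat := by
    rw [mForm, l, Module.Basis.constr_basis]; rfl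
  rw [lHat, map_sub, map_smul, h, h, Int.toNat_natCast]
  simp [mCoeff]

theorem mForm_bracket (z m₂ m₃ m₄ : ℂ) {x y : Virasoro} (hx : x ∈ aSub z) (hy : y ∈ aSub z) :
    mForm z m₂ m₃ m₄ ⁅x, y⁆ = 0 := by
  change mForm z m₂ m₃ m₄ (bracketBilin x y) = 0
  change x ∈ Submodule.span ℂ {x | ∃ k : ℕ, 2 ≤ k ∧ x = lHat z k} at hx
  change y ∈ Submodule.span ℂ {x | ∃ k : ℕ, 2 ≤ k ∧ x = lHat z k} at hy
  induction hx, hy using Submodule.span_induction₂ with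
  | mem_mem x y hx hy =>
    obtain ⟨i, hi, rfl⟩ := hx
    obtain ⟨j, hj, rfl⟩ := hy
    rw [bracketBilin_lHat z hi hj]
    simp only [map_add, map_sub, map_smul, mForm_lHat, smul_eq_mul]
    have h3 : mCoeff z m₂ m₃ m₄ 3 = m₃ := by simp [mCoeff]
    have hc (n : ℕ) : mCoeff z m₂ m₃ m₄ (n + 4) =
        -(n : ℂ) * m₃ * z ^ (n + 1) + ((n : ℂ) + 1) * m₄ * z ^ n := by
      rcases n with _ | n
      · simp [mCoeff]
      · rw [mCoeff, if_neg (by omega), if_neg (by omega), if_neg (by omega), if_neg (by omega)]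
        have p1 : n + 1 + 4 - 3 = n + 1 + 1 := by omega
        have p2 : n + 1 + 4 - 4 = n + 1 := by omega
        rw [p1, p2]
        push_cast
        ring
    obtain ⟨i, rfl⟩ : ∃ i', i = i' + 2 := ⟨i - 2, by omega⟩
    obtain ⟨j, rfl⟩ : ∃ j', j = j' + 2 := ⟨j - 2, by omega⟩
    have e1 : i + 2 + (j + 2) = i + j + 4 := by ring
    have p1 : i + 2 - 1 = i + 1 := by omega
    have p2 : j + 2 - 1 = j + 1 := by omega
    rw [e1, p1, p2, hc]
    rcases i with _ | i <;> rcases j with _ | j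
    · simp
    · have e2 : j + 1 + 2 + 1 = j + 4 := by ring
      rw [e2, hc, h3]
      push_cast
      ring
    · have e2 : i + 1 + 2 + 1 = i + 4 := by ring
      rw [e2, hc, h3]
      push_cast
      ring
    · have e2 : i + 1 + 2 + 1 = i + 4 := by ring
      have e3 : j + 1 + 2 + 1 = j + 4 := by ring
      rw [e2, e3, hc, hc]
      push_cast
      ring
  | zero_left y hy => simp
  | zero_right x hx => simp
  | add_left x y w _ _ _ h1 h2 => rw [map_add, LinearMap.add_apply, map_add, h1, h2, add_zero]
  | add_right x y w _ _ _ h1 h2 => rw [map_add, map_add, h1, h2, add_zero]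
  | smul_left t x y _ _ h => rw [map_smul, LinearMap.smul_apply, map_smul, h, smul_zero]
  | smul_right t x y _ _ h => rw [map_smul, map_smul, h, smul_zero]

/-- The `𝔞_z`-module `ℂ_𝐦`, with underlying vector space `ℂ`. -/
def CMod (_z _m₂ _m₃ _m₄ : ℂ) : Type := ℂ

namespace CMod

variable (z m₂ m₃ m₄ : ℂ)

instance : AddCommGroup (CMod z m₂ m₃ m₄) := inferInstanceAs (AddCommGroup ℂ)

instance : Module ℂ (CMod z m₂ m₃ m₄) := inferInstanceAs (Module ℂ ℂ)

/-- The canonical generator. -/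
def one : CMod z m₂ m₃ m₄ := (1 : ℂ)

instance : LieRingModule (aSub z) (CMod z m₂ m₃ m₄) where
  bracket x w := mForm z m₂ m₃ m₄ x • w
  add_lie x y w := by
    change mForm z m₂ m₃ m₄ ((x : Virasoro) + y) • w = _ • w + _ • w
    rw [map_add, add_smul]
  lie_add x v w := smul_add _ v w
  leibniz_lie x y w := by
    change mForm z m₂ m₃ m₄ x • mForm z m₂ m₃ m₄ y • w =
      mForm z m₂ m₃ m₄ ⁅(x : Virasoro), (y : Virasoro)⁆ • w +
        mForm z m₂ m₃ m₄ y • mForm z m₂ m₃ m₄ x • w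
    rw [mForm_bracket z m₂ m₃ m₄ x.2 y.2, zero_smul, zero_add, smul_comm]

theorem lie_def (x : aSub z) (w : CMod z m₂ m₃ m₄) : ⁅x, w⁆ = mForm z m₂ m₃ m₄ x • w := rfl

instance : LieModule ℂ (aSub z) (CMod z m₂ m₃ m₄) where
  smul_lie t x w := by
    change mForm z m₂ m₃ m₄ (t • (x : Virasoro)) • w = t • mForm z m₂ m₃ m₄ x • w
    rw [map_smul, smul_assoc]
  lie_smul t x w := by rw [lie_def, lie_def, smul_comm]

/-- The element `l k - z ^ (k - 1) l 1` of `𝔞_z` acts on `ℂ_𝐦` by the scalar `m_k`. -/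
theorem lie_lHat {k : ℕ} (hk : 2 ≤ k) (w : CMod z m₂ m₃ m₄) :
    ⁅(⟨lHat z k, lHat_mem_aSub z hk⟩ : aSub z), w⁆ = mCoeff z m₂ m₃ m₄ k • w := by
  rw [lie_def, mForm_lHat]

end CMod

/-- The `𝔫`-module `V_𝐦`, induced from the `𝔞_z`-module `ℂ_𝐦`. -/
abbrev VMod (z m₂ m₃ m₄ : ℂ) : Type :=
  InducedModule (CMod z m₂ m₃ m₄) (LieSubalgebra.inclusion (aSub_le_positivePart z))

/-- The `𝔟`-module `W_𝐦`, induced from the `𝔫`-module `V_𝐦`. -/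
abbrev WMod (z m₂ m₃ m₄ : ℂ) : Type :=
  InducedModule (VMod z m₂ m₃ m₄) (LieSubalgebra.inclusion positivePart_le_borel)

end Virasoro

end

noncomputable section

open Polynomial

namespace Virasoro

/-! ### Densities supported at a point -/

section WeylPair

variable {A : Type*} [Ring A] [Algebra ℂ A]

/-! The module `W_𝐦` is identified with a tensor product of two modules on which simplicity can be
read off. The first factor is a module of densities supported at the point `z`: on polynomials in
`y`, put `T = z + d/dy` and `Y = y`, so that `T Y - Y T = 1`, and let `l k` act as the vector field
of coefficient `T ^ (k + 1)` with parameter `c`. The second factor is induced to `𝔟` from a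
one-dimensional `𝔫`-module: on polynomials in `s`, let `l 0` be multiplication by `s`, let `l 1` and
`l 2` be `a` and `b` times the translations by `-1` and `-2`, and let `l k` be zero for `k ≥ 3`. For
a suitable choice of `c`, `a`, `b` the vector `1` satisfies the relations defining `ℂ_𝐦`, which
gives a map from `W_𝐦` to the model. The vectors `l 0 ^ j l 1 ^ i` applied to the generator span
`W_𝐦`, and their images are linearly independent (`applyPoly₂_lOp_injective`), so the map is
injective and no Poincaré–Birkhoff–Witt theorem is needed.

The model is simple (`eq_top_of_lOp_mem`) because the factors can be separated. The operators with
`k ≥ 3` see only the densities, and since `z ≠ 0`, on a given vector they realize every polynomial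
vector field. If `c ≠ 0`, these fields lower the degree in `y` until a nonzero polynomial in `s`
alone remains. If `a` or `b` is nonzero, a translation together with multiplication by `s` then
generates all polynomials in `s`, and multiplication by `y` gives the rest. The condition `c ≠ 0` is
`z m₃ ≠ m₄`, and `a = b = 0` happens only for the excluded triple. -/

theorem aeval_mul_of_weyl {T Y : A} (h : T * Y = Y * T + 1) (f : ℂ[X]) :
    aeval T f * Y = Y * aeval T f + aeval T (derivative f) := by
  induction f using Polynomial.induction_on' with
  | add p q hp hq => simp only [map_add, add_mul, mul_add, hp, hq]; abel
  | monomial n t =>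
    have key : ∀ n : ℕ, T ^ n * Y = Y * T ^ n + (n : A) * T ^ (n - 1) := by
      intro n
      induction n with
      | zero => simp
      | succ n ih =>
        rw [pow_succ', mul_assoc, ih, mul_add, ← mul_assoc, h, add_mul, one_mul]
        rcases n with _ | n
        · simp
        · have hc : T * ((n + 1 : ℕ) : A) = ((n + 1 : ℕ) : A) * T := (Nat.cast_commute _ _).symm
          rw [← mul_assoc T, hc, mul_assoc _ T, ← pow_succ']
          simp only [Nat.add_sub_cancel, Nat.cast_add, Nat.cast_one, add_mul, mul_assoc,
            pow_succ', one_mul]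
          abel
    rw [derivative_monomial, aeval_monomial, aeval_monomial, mul_assoc, key, mul_add, map_mul,
      map_natCast, ← mul_assoc, ← mul_assoc, Algebra.commutes t Y, ← mul_assoc]

/-- The operator by which the vector field `f ∂` acts on densities of weight `c`, written in terms
of a Weyl pair `T`, `Y`. -/
def densityOp (T Y : A) (c : ℂ) : ℂ[X] →ₗ[ℂ] A :=
  c • ((aeval T).toLinearMap ∘ₗ derivative) - LinearMap.mulLeft ℂ Y ∘ₗ (aeval T).toLinearMap

theorem densityOp_apply (T Y : A) (c : ℂ) (f : ℂ[X]) :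
    densityOp T Y c f = c • aeval T (derivative f) - Y * aeval T f := rfl

/-- With `T` as coordinate and `-Y` as `d/dT`, the operator attached to `f` is `f ∂ + (c + 1) f'`,
so this is the bracket of vector fields. The proof moves every `Y` to the left. -/
theorem densityOp_commutator {T Y : A} (h : T * Y = Y * T + 1) (c : ℂ) (f g : ℂ[X]) :
    densityOp T Y c f * densityOp T Y c g - densityOp T Y c g * densityOp T Y c f =
      densityOp T Y c (f * derivative g - derivative f * g) := by
  have hf := aeval_mul_of_weyl h f
  have hg := aeval_mul_of_weyl h g
  have hf' := aeval_mul_of_weyl h (derivative f)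
  have hg' := aeval_mul_of_weyl h (derivative g)
  have comm (p q : ℂ[X]) : aeval T p * aeval T q = aeval T q * aeval T p := by
    rw [← map_mul, mul_comm, map_mul]
  simp only [densityOp_apply, derivative_mul, map_sub, map_add, map_mul]
  set F := aeval T f
  set G := aeval T g
  set F' := aeval T (derivative f)
  set G' := aeval T (derivative g)
  set F'' := aeval T (derivative (derivative f))
  set G'' := aeval T (derivative (derivative g))
  have e1 : F * G' = G' * F := comm _ _
  have e2 : F' * G = G * F' := comm _ _
  have e3 : F' * G' = G' * F' := comm _ _
  have e4 : F * G = G * F := comm _ _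
  have e5 : F * G'' = G'' * F := comm _ _
  have e6 : F'' * G = G * F'' := comm _ _
  simp only [sub_mul, mul_sub, smul_mul_assoc, mul_smul_comm, ← mul_assoc, hf', hg', add_mul]
  simp only [mul_assoc Y F Y, mul_assoc Y G Y, hf, hg]
  simp only [mul_add, add_mul, ← mul_assoc]
  simp only [mul_assoc Y, e1, e2, e3, e4, e5, e6, smul_sub, smul_add]
  abel

end WeylPair

/-! ### A concrete model -/

namespace Model

section Operators

variable {S : Type*} [CommRing S] [Algebra ℂ S]

/-- Multiplication by the variable. -/
def mulY (S : Type*) [CommRing S] [Algebra ℂ S] : Module.End ℂ S[X] := LinearMap.mulLeft ℂ X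

/-- The operator `z + d/dy`. -/
def dZ (S : Type*) [CommRing S] [Algebra ℂ S] (z : ℂ) : Module.End ℂ S[X] :=
  algebraMap ℂ _ z + (derivative (R := S)).restrictScalars ℂ

/-- Multiplication by a scalar of the coefficient algebra. -/
def mulC (s : S) : Module.End ℂ S[X] := LinearMap.mulLeft ℂ (C s)

/-- The coefficientwise application of an endomorphism. -/
def mapS (σ : S →ₐ[ℂ] S) : Module.End ℂ S[X] := (mapAlgHom σ).toLinearMap

theorem mulY_apply (w : S[X]) : mulY S w = X * w := rfl
theorem mulC_apply (s : S) (w : S[X]) : mulC s w = C s * w := rfl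
theorem mapS_apply (σ : S →ₐ[ℂ] S) (w : S[X]) : mapS σ w = w.map σ.toRingHom := rfl
theorem dZ_apply (z : ℂ) (w : S[X]) : dZ S z w = z • w + derivative w := rfl

theorem dZ_mul_mulY (z : ℂ) : dZ S z * mulY S = mulY S * dZ S z + 1 := by
  ext1 w
  simp only [Module.End.mul_apply, LinearMap.add_apply, Module.End.one_apply, dZ_apply, mulY_apply,
    derivative_mul, derivative_X, mul_add, mul_smul_comm]
  ring

theorem mapS_mul_mulC {s : S} {σ : S →ₐ[ℂ] S} (h : σ s = s - 1) :
    mapS σ * mulC s = mulC s * mapS σ - mapS σ := by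
  ext1 w
  simp only [Module.End.mul_apply, LinearMap.sub_apply, mapS_apply, mulC_apply,
    Polynomial.map_mul, map_C]
  have : σ.toRingHom s = s - 1 := h
  rw [this, C_sub, C_1]
  ring

theorem commute_dZ_mulC (z : ℂ) (s : S) : Commute (dZ S z) (mulC s) := by
  ext1 w
  simp only [Module.End.mul_apply, dZ_apply, mulC_apply, derivative_C_mul, mul_add, mul_smul_comm]

theorem commute_mulY_mulC (s : S) : Commute (mulY S) (mulC s) := by
  ext1 w
  simp only [Module.End.mul_apply, mulY_apply, mulC_apply]
  ring

theorem commute_dZ_mapS (z : ℂ) (σ : S →ₐ[ℂ] S) : Commute (dZ S z) (mapS σ) := by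
  ext1 w
  simp only [Module.End.mul_apply, dZ_apply, map_add, map_smul]
  simp only [mapS_apply, derivative_map]

theorem commute_mulY_mapS (σ : S →ₐ[ℂ] S) : Commute (mulY S) (mapS σ) := by
  ext1 w
  simp only [Module.End.mul_apply, mulY_apply, mapS_apply, Polynomial.map_mul, map_X]

/-- The action of `l k` on the Whittaker factor. -/
def whittakerOp (s : S) (σ : S →ₐ[ℂ] S) (a b : ℂ) : ℕ → Module.End ℂ S[X]
  | 0 => mulC s
  | 1 => a • mapS σ
  | 2 => b • (mapS σ * mapS σ)
  | _ => 0

variable {s : S} {σ : S →ₐ[ℂ] S}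

theorem whittakerOp_of_three_le (a b : ℂ) {k : ℕ} (hk : 3 ≤ k) : whittakerOp s σ a b k = 0 := by
  obtain ⟨k, rfl⟩ : ∃ j, k = j + 3 := ⟨k - 3, by omega⟩
  rfl

theorem commute_whittakerOp {U : Module.End ℂ S[X]} (h₁ : Commute U (mulC s))
    (h₂ : Commute U (mapS σ)) (a b : ℂ) (k : ℕ) : Commute U (whittakerOp s σ a b k) := by
  match k with
  | 0 => exact h₁
  | 1 => exact h₂.smul_right a
  | 2 => exact (h₂.mul_right h₂).smul_right b
  | k + 3 => exact Commute.zero_right _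

theorem mulC_whittakerOp (h : σ s = s - 1) (a b : ℂ) (j : ℕ) :
    mulC s * whittakerOp s σ a b j - whittakerOp s σ a b j * mulC s =
      (j : ℂ) • whittakerOp s σ a b j := by
  have hS := mapS_mul_mulC h
  match j with
  | 0 => simp [whittakerOp]
  | 1 =>
    simp only [whittakerOp, smul_mul_assoc, mul_smul_comm, hS]
    module
  | 2 =>
    simp only [whittakerOp, smul_mul_assoc, mul_smul_comm, mul_assoc, hS, mul_sub]
    rw [← mul_assoc (mapS σ) (mulC s), hS, sub_mul, mul_assoc]
    push_cast
    module
  | j + 3 => simp [whittakerOp]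

/-- Bracketing with `l 0` is the relation `σ s = s - 1`. For `i, j ≥ 1` the operators commute, and
the right side vanishes as well: either `i = j`, or `i + j ≥ 3`. -/
theorem whittakerOp_commutator (h : σ s = s - 1) (a b : ℂ) (i j : ℕ) :
    whittakerOp s σ a b i * whittakerOp s σ a b j - whittakerOp s σ a b j * whittakerOp s σ a b i =
      ((j : ℂ) - i) • whittakerOp s σ a b (i + j) := by
  have hcomm : ∀ i' j' : ℕ, 1 ≤ i' → 1 ≤ j' →
      Commute (whittakerOp s σ a b i') (whittakerOp s σ a b j') := by
    have h : ∀ i', 1 ≤ i' → Commute (mapS σ) (whittakerOp s σ a b i') := by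
      intro i' hi
      match i', hi with
      | 1, _ => exact (Commute.refl _).smul_right a
      | 2, _ => exact ((Commute.refl _).mul_right (Commute.refl _)).smul_right b
      | k + 3, _ => exact Commute.zero_right _
    intro i' j' hi hj
    match i', hi with
    | 1, _ => exact (h j' hj).smul_left a
    | 2, _ => exact ((h j' hj).mul_left (h j' hj)).smul_left b
    | k + 3, _ => exact Commute.zero_left _
  rcases Nat.eq_zero_or_pos i with rfl | hi
  · simpa [whittakerOp] using mulC_whittakerOp h a b j
  rcases Nat.eq_zero_or_pos j with rfl | hj
  · have := mulC_whittakerOp h a b i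
    change whittakerOp s σ a b i * mulC s - mulC s * whittakerOp s σ a b i = _
    rw [← neg_sub, this, Nat.cast_zero, zero_sub, add_zero]
    module
  rw [(hcomm i j hi hj).eq, sub_self]
  by_cases hij : i = j
  · simp [hij]
  · rw [whittakerOp_of_three_le a b (by omega), smul_zero]

/-- The action of `l k`, `k ≥ 0`, on the model. -/
def lOp (s : S) (σ : S →ₐ[ℂ] S) (z c a b : ℂ) (k : ℕ) : Module.End ℂ S[X] :=
  densityOp (dZ S z) (mulY S) c (X ^ (k + 1)) + whittakerOp s σ a b k

theorem commute_aeval_whittakerOp (z a b : ℂ) (f : ℂ[X]) (k : ℕ) :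
    Commute (aeval (dZ S z) f) (whittakerOp s σ a b k) := by
  induction f using Polynomial.induction_on' with
  | add p q hp hq => rw [map_add]; exact hp.add_left hq
  | monomial n t =>
    rw [aeval_monomial]
    exact (Algebra.commute_algebraMap_left t _).mul_left
      ((commute_whittakerOp (commute_dZ_mulC z s) (commute_dZ_mapS z σ) a b k).pow_left n)

theorem commute_densityOp_whittakerOp (z c a b : ℂ) (f : ℂ[X]) (k : ℕ) :
    Commute (densityOp (dZ S z) (mulY S) c f) (whittakerOp s σ a b k) := by
  rw [densityOp_apply]
  exact ((commute_aeval_whittakerOp z a b _ k).smul_left c).sub_left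
    ((commute_whittakerOp (commute_mulY_mulC s) (commute_mulY_mapS σ) a b k).mul_left
      (commute_aeval_whittakerOp z a b _ k))

/-- The two actions involve different variables and commute, so their brackets add up. -/
theorem lOp_commutator (h : σ s = s - 1) (z c a b : ℂ) (i j : ℕ) :
    lOp s σ z c a b i * lOp s σ z c a b j - lOp s σ z c a b j * lOp s σ z c a b i =
      ((j : ℂ) - i) • lOp s σ z c a b (i + j) := by
  have h1 := densityOp_commutator (dZ_mul_mulY (S := S) z) c (X ^ (i + 1)) (X ^ (j + 1))
  have h2 := whittakerOp_commutator h a b i j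
  have h3 := (commute_densityOp_whittakerOp (s := s) (σ := σ) z c a b (X ^ (i + 1)) j).eq
  have h4 := (commute_densityOp_whittakerOp (s := s) (σ := σ) z c a b (X ^ (j + 1)) i).eq
  have h5 : (X ^ (i + 1) * derivative (X ^ (j + 1)) - derivative (X ^ (i + 1)) * X ^ (j + 1) :
      ℂ[X]) = ((j : ℂ) - i) • X ^ (i + j + 1) := by
    simp only [derivative_X_pow, Nat.add_sub_cancel, smul_eq_C_mul, C_sub, Nat.cast_add,
      Nat.cast_one, map_natCast, C_add, C_1]
    ring
  rw [h5, map_smul] at h1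
  rw [lOp, lOp, lOp, smul_add, ← h1, ← h2]
  simp only [add_mul, mul_add, h3, h4]
  abel

end Operators

/-! ### Simplicity of the model -/

section Simplicity

variable {S : Type*} [CommRing S] [Algebra ℂ S] {s : S} {σ : S →ₐ[ℂ] S} {z c a b : ℂ}

theorem aeval_dZ_sub_pow (z : ℂ) (D : ℕ) (w : S[X]) :
    aeval (dZ S z) ((X - C z) ^ D) w = derivative^[D] w := by
  have h (v : S[X]) : aeval (dZ S z) (X - C z) v = derivative v := by
    rw [map_sub, aeval_X, aeval_C, dZ, add_sub_cancel_left]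
    rfl
  induction D with
  | zero => simp
  | succ D ih =>
    rw [pow_succ', map_mul, Module.End.mul_apply, ih, h, Function.iterate_succ_apply']

theorem aeval_dZ_pow_mul_eq_zero (z : ℂ) {D : ℕ} {w : S[X]} (hw : w.natDegree < D) (g : ℂ[X]) :
    aeval (dZ S z) ((X - C z) ^ D * g) w = 0 := by
  rw [mul_comm, map_mul, Module.End.mul_apply, aeval_dZ_sub_pow, iterate_derivative_eq_zero hw,
    map_zero]

/-- On the model `T - z` is `d/dy`, hence nilpotent on each vector. The exponent is `D + 1` because
the term with the derivative of the field loses one power. -/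
theorem densityOp_pow_mul_eq_zero (z c : ℂ) {D : ℕ} {w : S[X]} (hw : w.natDegree < D) (g : ℂ[X]) :
    densityOp (dZ S z) (mulY S) c ((X - C z) ^ (D + 1) * g) w = 0 := by
  have hd : derivative ((X - C z) ^ (D + 1) * g) =
      (X - C z) ^ D * (C ((D : ℂ) + 1) * g + (X - C z) * derivative g) := by
    simp only [derivative_mul, derivative_X_sub_C_pow, Nat.add_sub_cancel, Nat.cast_add,
      Nat.cast_one, C_add, C_1, map_natCast]
    ring
  rw [densityOp_apply, hd, LinearMap.sub_apply, LinearMap.smul_apply,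
    aeval_dZ_pow_mul_eq_zero z hw, smul_zero, Module.End.mul_apply, pow_succ, mul_assoc,
    aeval_dZ_pow_mul_eq_zero z hw, map_zero, sub_zero]

variable {K : Submodule ℂ S[X]}

/-- The fields divisible by `X ^ 4` are the combinations of those of `l k` with `k ≥ 3`, where the
Whittaker factor acts by zero. -/
theorem densityOp_X_pow_mul_mem (hK : ∀ k, ∀ w ∈ K, lOp s σ z c a b k w ∈ K) (g : ℂ[X]) {w : S[X]}
    (hw : w ∈ K) : densityOp (dZ S z) (mulY S) c (X ^ 4 * g) w ∈ K := by
  induction g using Polynomial.induction_on' with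
  | add p q hp hq => rw [mul_add, map_add]; exact add_mem hp hq
  | monomial n t =>
    have h := hK (n + 3) w hw
    rw [lOp, whittakerOp_of_three_le a b (by omega), add_zero] at h
    have e : (X ^ 4 * monomial n t : ℂ[X]) = t • X ^ (n + 3 + 1) := by
      rw [← C_mul_X_pow_eq_monomial, smul_eq_C_mul]
      ring
    rw [e, map_smul]
    exact K.smul_mem t h

/-- Since `z ≠ 0`, `X ^ 4` is coprime to every power of `X - z`, so each field is a multiple of `X ^
4` plus one vanishing at `z` to an order high enough to annihilate `w`. -/
theorem densityOp_mem (hz : z ≠ 0) (hK : ∀ k, ∀ w ∈ K, lOp s σ z c a b k w ∈ K) (h : ℂ[X])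
    {w : S[X]} (hw : w ∈ K) : densityOp (dZ S z) (mulY S) c h w ∈ K := by
  have hcop : IsCoprime ((X : ℂ[X]) ^ 4) ((X - C z) ^ (w.natDegree + 1 + 1)) := by
    refine IsCoprime.pow ⟨C z⁻¹, -C z⁻¹, ?_⟩
    have : (C z⁻¹ * C z : ℂ[X]) = 1 := by rw [← C_mul, inv_mul_cancel₀ hz, C_1]
    linear_combination this
  obtain ⟨u, v, huv⟩ := hcop
  have e : h = X ^ 4 * (h * u) + (X - C z) ^ (w.natDegree + 1 + 1) * (v * h) := by
    linear_combination -h * huv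
  rw [e, map_add, LinearMap.add_apply, densityOp_pow_mul_eq_zero z c (Nat.lt_succ_self _),
    add_zero]
  exact densityOp_X_pow_mul_mem hK _ hw

/-- The constant field `1`, which would be that of `l (-1)`, acts by `-y`. -/
theorem X_mul_mem (hz : z ≠ 0) (hK : ∀ k, ∀ w ∈ K, lOp s σ z c a b k w ∈ K) {w : S[X]}
    (hw : w ∈ K) : X * w ∈ K := by
  have h := densityOp_mem hz hK 1 hw
  rw [densityOp_apply, derivative_one, map_zero, smul_zero, zero_sub, map_one, mul_one] at h
  exact neg_mem_iff.mp h

/-- This is the action of the field `(X - z) ^ (j + 1)`. -/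
theorem derivative_mem (hz : z ≠ 0) (hK : ∀ k, ∀ w ∈ K, lOp s σ z c a b k w ∈ K) {w : S[X]}
    (hw : w ∈ K) (j : ℕ) :
    (c * (j + 1 : ℕ)) • derivative^[j] w - X * derivative^[j + 1] w ∈ K := by
  have h := densityOp_mem hz hK ((X - C z) ^ (j + 1)) hw
  have hd : derivative ((X - C z) ^ (j + 1) : ℂ[X]) = ((j + 1 : ℕ) : ℂ) • (X - C z) ^ j := by
    rw [derivative_X_sub_C_pow, Nat.add_sub_cancel, smul_eq_C_mul, map_natCast]
  rw [densityOp_apply, hd, map_smul, LinearMap.sub_apply, LinearMap.smul_apply,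
    LinearMap.smul_apply, Module.End.mul_apply, aeval_dZ_sub_pow, aeval_dZ_sub_pow, mulY_apply,
    smul_smul] at h
  exact h

theorem coeff_derivative_combination (c : ℂ) (j n : ℕ) (w : S[X]) :
    ((c * (j + 1 : ℕ)) • derivative^[j] w - X * derivative^[j + 1] w).coeff n =
      (((n + j).descFactorial j : ℂ) * (c * (j + 1 : ℕ) - n)) • w.coeff (n + j) := by
  rw [coeff_sub, coeff_smul, coeff_iterate_derivative]
  rcases n with _ | n
  · simp only [coeff_X_mul_zero, Nat.cast_zero, sub_zero, ← Nat.cast_smul_eq_nsmul ℂ, smul_smul]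
    ring_nf
  · have e : n + (j + 1) = n + 1 + j := by omega
    have hd : (n + 1 + j).descFactorial (j + 1) = (n + 1) * (n + 1 + j).descFactorial j := by
      rw [Nat.descFactorial_succ]
      congr 1
      omega
    rw [coeff_X_mul, coeff_iterate_derivative, e, hd, ← Nat.cast_smul_eq_nsmul ℂ,
      ← Nat.cast_smul_eq_nsmul ℂ, smul_smul, ← sub_smul]
    push_cast
    ring_nf

/-- Induction on the degree `n` in `y`. By `derivative_mem` a vector is replaced by one of degree at
most `n - j`, whose coefficient there is the old leading one times a nonzero integer times `c (j +
1) - (n - j)`. One of `j = 1`, `j = 2` always gives a nonzero factor. -/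
theorem exists_C_mem [IsDomain S] (hz : z ≠ 0) (hc : c ≠ 0)
    (hK : ∀ k, ∀ w ∈ K, lOp s σ z c a b k w ∈ K) (hne : K ≠ ⊥) : ∃ p : S, p ≠ 0 ∧ C p ∈ K := by
  obtain ⟨w₀, hw₀, hne₀⟩ := K.ne_bot_iff.mp hne
  induction hn : w₀.natDegree using Nat.strong_induction_on generalizing w₀ with
  | _ n ih =>
    rcases Nat.eq_zero_or_pos n with rfl | hpos
    · obtain ⟨p, hp⟩ := natDegree_eq_zero.mp hn
      subst hp
      exact ⟨p, fun h => hne₀ (by rw [h, C_0]), hw₀⟩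
    have lead : w₀.coeff n ≠ 0 := by
      rw [← hn]; exact leadingCoeff_ne_zero.mpr hne₀
    have step : ∀ j, 1 ≤ j → j ≤ n → (c * (j + 1 : ℕ) - ((n - j : ℕ) : ℂ)) ≠ 0 →
        ∃ p : S, p ≠ 0 ∧ C p ∈ K := by
      intro j hj hjn h
      have hmem := derivative_mem hz hK hw₀ j
      set v := (c * (j + 1 : ℕ)) • derivative^[j] w₀ - X * derivative^[j + 1] w₀ with hv
      have hcoeff : v.coeff (n - j) ≠ 0 := by
        rw [hv, coeff_derivative_combination, Nat.sub_add_cancel hjn]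
        refine smul_ne_zero (mul_ne_zero ?_ h) lead
        exact_mod_cast (Nat.descFactorial_pos.mpr hjn).ne'
      have hdeg : v.natDegree ≤ n - j := by
        rw [natDegree_le_iff_coeff_eq_zero]
        intro m hm
        rw [hv, coeff_derivative_combination, coeff_eq_zero_of_natDegree_lt (by omega), smul_zero]
      exact ih v.natDegree (by omega) v hmem (fun h0 => hcoeff (by rw [h0, coeff_zero])) rfl
    -- Vanishing for `j = 1` means `2 c = n - 1`. If `n = 1` this contradicts `c ≠ 0`; otherwise `j
    -- = 2` applies, since `3 c = n - 2` as well would force `n = -1`.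
    by_cases h1 : c * (1 + 1 : ℕ) - ((n - 1 : ℕ) : ℂ) = 0
    · have hn2 : 2 ≤ n := by
        by_contra hlt
        have : n = 1 := by omega
        subst this
        apply hc
        simpa using h1
      refine step 2 (by omega) hn2 fun h2 => ?_
      rw [Nat.cast_sub (by omega)] at h1 h2
      push_cast at h1 h2
      have h3 : (n : ℂ) + 1 = 0 := by linear_combination 2 * h2 - 3 * h1
      exact Nat.cast_add_one_ne_zero n h3
    · exact step 1 le_rfl hpos h1

theorem densityOp_C (z c : ℂ) (k : ℕ) (p : S) :
    densityOp (dZ S z) (mulY S) c (X ^ (k + 1)) (C p) =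
      (c * ((k + 1 : ℕ) * z ^ k)) • C p - z ^ (k + 1) • (X * C p) := by
  have h (n : ℕ) : aeval (dZ S z) (X ^ n : ℂ[X]) (C p) = z ^ n • C p := by
    induction n with
    | zero => simp
    | succ n ih =>
      rw [pow_succ', map_mul, Module.End.mul_apply, ih, aeval_X, dZ_apply, derivative_smul,
        derivative_C, smul_zero, add_zero, smul_smul, ← pow_succ']
  have hd : derivative (X ^ (k + 1) : ℂ[X]) = ((k + 1 : ℕ) : ℂ) • X ^ k := by
    rw [derivative_X_pow, Nat.add_sub_cancel, smul_eq_C_mul, map_natCast]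
  rw [densityOp_apply, hd, map_smul, LinearMap.sub_apply, LinearMap.smul_apply,
    LinearMap.smul_apply, Module.End.mul_apply, h, h, mulY_apply, smul_smul, smul_smul,
    mul_smul_comm, mul_assoc]

/-- All density operators preserve `K`, hence on constants in `y` the Whittaker part of each `l k`
does so separately. The constants in `K` thus form a nonzero subspace of `S` to which `hS` applies.
-/
theorem eq_top_of_lOp_mem [IsDomain S] (hz : z ≠ 0) (hc : c ≠ 0)
    (hS : ∀ J : Submodule ℂ S, (∀ p ∈ J, s * p ∈ J) → (∀ p ∈ J, a • σ p ∈ J) →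
      (∀ p ∈ J, b • σ (σ p) ∈ J) → J ≠ ⊥ → J = ⊤)
    (hK : ∀ k, ∀ w ∈ K, lOp s σ z c a b k w ∈ K) (hne : K ≠ ⊥) : K = ⊤ := by
  have hwh : ∀ k, ∀ p : S, C p ∈ K → whittakerOp s σ a b k (C p) ∈ K := by
    intro k p hp
    have h := hK k _ hp
    rw [lOp, LinearMap.add_apply] at h
    refine (K.add_mem_iff_right ?_).mp h
    rw [densityOp_C]
    exact sub_mem (K.smul_mem _ hp) (K.smul_mem _ (X_mul_mem hz hK hp))
  have hJ : K.comap (CAlgHom (R := ℂ) (A := S)).toLinearMap = ⊤ := by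
    refine hS _ (fun p hp => ?_) (fun p hp => ?_) (fun p hp => ?_) ?_
    · have h := hwh 0 p hp
      change C (s * p) ∈ K
      rw [C_mul]
      exact h
    · have h := hwh 1 p hp
      change C (a • σ p) ∈ K
      rw [← smul_C]
      simpa [whittakerOp, mapS_apply] using h
    · have h := hwh 2 p hp
      change C (b • σ (σ p)) ∈ K
      rw [← smul_C]
      simpa [whittakerOp, mapS_apply] using h
    · obtain ⟨p, hp, hpK⟩ := exists_C_mem hz hc hK hne
      exact (Submodule.ne_bot_iff _).mpr ⟨p, hpK, hp⟩
  have hC : ∀ p : S, C p ∈ K := fun p => by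
    have : p ∈ K.comap (CAlgHom (R := ℂ) (A := S)).toLinearMap := hJ ▸ Submodule.mem_top
    exact this
  refine eq_top_iff.mpr fun w _ => ?_
  induction w using Polynomial.induction_on with
  | C p => exact hC p
  | add p q hp hq => exact add_mem (hp trivial) (hq trivial)
  | monomial n p h =>
    have := X_mul_mem hz hK (h trivial)
    rwa [mul_left_comm, ← pow_succ'] at this

end Simplicity

/-- A nonzero subspace of `ℂ[X]` that is stable under multiplication by `X` and under a nonzero
translation is everything. -/
theorem eq_top_of_taylor_mem {J : Submodule ℂ ℂ[X]} (hX : ∀ p ∈ J, X * p ∈ J) {r : ℂ}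
    (hr : r ≠ 0) (hσ : ∀ p ∈ J, taylor r p ∈ J) (hne : J ≠ ⊥) : J = ⊤ := by
  have hone : (1 : ℂ[X]) ∈ J := by
    obtain ⟨p, hp, hp0⟩ := J.ne_bot_iff.mp hne
    induction hn : p.natDegree using Nat.strong_induction_on generalizing p with
    | _ n ih =>
      rcases Nat.eq_zero_or_pos n with rfl | hpos
      · obtain ⟨t, rfl⟩ := natDegree_eq_zero.mp hn
        have ht : t ≠ 0 := fun h => hp0 (by rw [h, C_0])
        have := J.smul_mem t⁻¹ hp
        rwa [smul_C, smul_eq_mul, inv_mul_cancel₀ ht, C_1] at this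
      · have hdeg : (taylor r p - p).degree < p.degree := by
          exact degree_sub_lt_right (degree_taylor p r) hp0 (leadingCoeff_taylor ..)
        -- A translation-invariant polynomial takes the value `p 0` at all the multiples `k r`, so
        -- it is constant.
        have hq0 : taylor r p - p ≠ 0 := by
          intro h0
          have hev : ∀ k : ℕ, p.eval (k * r) = p.eval 0 := by
            intro k
            induction k with
            | zero => simp
            | succ k ihk =>
              rw [← ihk, Nat.cast_succ, add_mul, one_mul, ← taylor_eval, sub_eq_zero.mp h0]
          have hinf : Set.Infinite {x | IsRoot (p - C (p.eval 0)) x} := by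
            refine (Set.infinite_range_of_injective (f := fun k : ℕ => (k : ℂ) * r) ?_).mono ?_
            · intro i j hij
              exact_mod_cast mul_right_cancel₀ hr hij
            · rintro _ ⟨k, rfl⟩
              simp [hev k]
          have := sub_eq_zero.mp (eq_zero_of_infinite_isRoot _ hinf)
          rw [this, natDegree_C] at hn
          omega
        exact ih _ (hn ▸ natDegree_lt_natDegree hq0 hdeg) _ (sub_mem (hσ p hp) hp) hq0 rfl
  refine eq_top_iff.mpr fun w _ => ?_
  induction w using Polynomial.induction_on with
  | C p => simpa [smul_eq_C_mul] using J.smul_mem p hone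
  | add p q hp hq => exact add_mem (hp trivial) (hq trivial)
  | monomial n p h =>
    have := hX _ (h trivial)
    rwa [mul_left_comm, ← pow_succ'] at this

end Model

end Virasoro

open scoped TensorProduct

/-! ### The universal property of induced modules -/

section

attribute [local instance 100] LieRing.ofAssociativeRing

/-- The universal property gives a map into `S` which, followed by the inclusion, fixes the
generators and is therefore the identity. -/
theorem UniversalEnvelopingAlgebra.mem_of_ι_mem {R : Type*} [CommRing R] {L : Type*} [LieRing L]
    [LieAlgebra R L] (S : Subalgebra R (UniversalEnvelopingAlgebra R L))
    (h : ∀ x, UniversalEnvelopingAlgebra.ι R x ∈ S) (a : UniversalEnvelopingAlgebra R L) :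
    a ∈ S := by
  let j : L →ₗ⁅R⁆ S :=
    { (UniversalEnvelopingAlgebra.ι R (L := L) : L →ₗ[R] _).codRestrict
        (Subalgebra.toSubmodule S) h with
      map_lie' := by
        intro x y
        exact Subtype.ext ((UniversalEnvelopingAlgebra.ι R).map_lie x y) }
  have hF : S.val.comp (UniversalEnvelopingAlgebra.lift R j) = AlgHom.id R _ := by
    apply UniversalEnvelopingAlgebra.hom_ext
    ext x
    exact congrArg Subtype.val (UniversalEnvelopingAlgebra.lift_ι_apply' R j x)
  have := congrFun (congrArg DFunLike.coe hF) a
  change ((UniversalEnvelopingAlgebra.lift R j a : S) : UniversalEnvelopingAlgebra R L) = a at this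
  rw [← this]
  exact (UniversalEnvelopingAlgebra.lift R j a).2

end

namespace InducedModule

attribute [local instance 100] LieRing.ofAssociativeRing

variable {R : Type*} [CommRing R]
  {H : Type*} [LieRing H] [LieAlgebra R H] {G : Type*} [LieRing G] [LieAlgebra R G]
  {V : Type*} [AddCommGroup V] [Module R V] [LieRingModule H V] [LieModule R H V]
  {N : Type*} [AddCommGroup N] [Module R N]

theorem lift_envelopingMap (f : H →ₗ⁅R⁆ G) (ρ : G →ₗ⁅R⁆ Module.End R N) (g : V →ₗ[R] N)
    (hg : ∀ (x : H) (v : V), g ⁅x, v⁆ = ρ (f x) (g v)) (a : UniversalEnvelopingAlgebra R H)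
    (v : V) : UniversalEnvelopingAlgebra.lift R ρ (envelopingMap f a) (g v) =
      g (envelopingAction V a v) := by
  let S : Subalgebra R (UniversalEnvelopingAlgebra R H) :=
    { carrier := {a | ∀ v, UniversalEnvelopingAlgebra.lift R ρ (envelopingMap f a) (g v) =
        g (envelopingAction V a v)}
      mul_mem' := by
        intro a b ha hb v
        rw [map_mul, map_mul, map_mul, Module.End.mul_apply, Module.End.mul_apply, hb, ha]
      add_mem' := by
        intro a b ha hb v
        rw [map_add, map_add, map_add, LinearMap.add_apply, LinearMap.add_apply, map_add, hb, ha]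
      algebraMap_mem' := by
        intro r v
        rw [AlgHom.commutes, AlgHom.commutes, AlgHom.commutes, Module.algebraMap_end_apply,
          Module.algebraMap_end_apply, map_smul] }
  refine UniversalEnvelopingAlgebra.mem_of_ι_mem S (fun x v => ?_) a v
  rw [envelopingMap_ι, envelopingAction_ι, hg]
  exact congrFun (congrArg DFunLike.coe (UniversalEnvelopingAlgebra.lift_ι_apply' R ρ (f x))) _

/-- The quotient map onto an induced module. -/
def mk (f : H →ₗ⁅R⁆ G) :
    UniversalEnvelopingAlgebra R G ⊗[R] V →ₗ[UniversalEnvelopingAlgebra R G] InducedModule V f :=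
  (balancedRelations V f).mkQ

theorem mk_surjective (f : H →ₗ⁅R⁆ G) : Function.Surjective (mk (V := V) f) :=
  (balancedRelations V f).mkQ_surjective

theorem tmul_eq_mk (f : H →ₗ⁅R⁆ G) (u : UniversalEnvelopingAlgebra R G) (v : V) :
    tmul V f u v = mk f (u ⊗ₜ[R] v) := rfl

/-- The linear map `u ⊗ v ↦ u • g v`. -/
def tensorLift (ρ : G →ₗ⁅R⁆ Module.End R N) (g : V →ₗ[R] N) :
    UniversalEnvelopingAlgebra R G ⊗[R] V →ₗ[R] N :=
  TensorProduct.lift ((LinearMap.lcomp R N g) ∘ₗ (UniversalEnvelopingAlgebra.lift R ρ).toLinearMap)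

theorem tensorLift_tmul (ρ : G →ₗ⁅R⁆ Module.End R N) (g : V →ₗ[R] N)
    (u : UniversalEnvelopingAlgebra R G) (v : V) :
    tensorLift ρ g (u ⊗ₜ v) = UniversalEnvelopingAlgebra.lift R ρ u (g v) := rfl

theorem tensorLift_smul (ρ : G →ₗ⁅R⁆ Module.End R N) (g : V →ₗ[R] N)
    (u : UniversalEnvelopingAlgebra R G) (t : UniversalEnvelopingAlgebra R G ⊗[R] V) :
    tensorLift ρ g (u • t) = UniversalEnvelopingAlgebra.lift R ρ u (tensorLift ρ g t) := by
  induction t using TensorProduct.induction_on with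
  | zero => simp
  | add x y hx hy => rw [smul_add, map_add, hx, hy, map_add, map_add]
  | tmul x v =>
    rw [TensorProduct.smul_tmul', smul_eq_mul, tensorLift_tmul, tensorLift_tmul, map_mul,
      Module.End.mul_apply]

/-- The relations span a `U(G)`-submodule while `tensorLift` is only `R`-linear; `tensorLift_smul`
shows that its kernel is nevertheless stable under `U(G)`. -/
theorem balancedRelations_le_ker (f : H →ₗ⁅R⁆ G) (ρ : G →ₗ⁅R⁆ Module.End R N) (g : V →ₗ[R] N)
    (hg : ∀ (x : H) (v : V), g ⁅x, v⁆ = ρ (f x) (g v)) :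
    (balancedRelations V f).restrictScalars R ≤ LinearMap.ker (tensorLift ρ g) := by
  intro t ht
  rw [LinearMap.mem_ker]
  induction (show t ∈ balancedRelations V f from ht) using Submodule.span_induction with
  | mem x hx =>
    obtain ⟨u, a, v, rfl⟩ := hx
    rw [map_sub, tensorLift_tmul, tensorLift_tmul, map_mul, Module.End.mul_apply,
      lift_envelopingMap f ρ g hg, sub_self]
  | zero => simp
  | add x y hx' hy' hx hy => rw [map_add, hx hx', hy hy', add_zero]
  | smul u x hx' hx => rw [tensorLift_smul, hx hx', map_zero]

/-- The linear map out of an induced module determined by an `H`-equivariant map `g`. -/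
def lift (f : H →ₗ⁅R⁆ G) (ρ : G →ₗ⁅R⁆ Module.End R N) (g : V →ₗ[R] N)
    (hg : ∀ (x : H) (v : V), g ⁅x, v⁆ = ρ (f x) (g v)) : InducedModule V f →ₗ[R] N :=
  (Submodule.liftQ _ _ (balancedRelations_le_ker f ρ g hg)) ∘ₗ
    (Submodule.Quotient.restrictScalarsEquiv R (balancedRelations V f)).symm.toLinearMap

theorem lift_mk (f : H →ₗ⁅R⁆ G) (ρ : G →ₗ⁅R⁆ Module.End R N) (g : V →ₗ[R] N)
    (hg : ∀ (x : H) (v : V), g ⁅x, v⁆ = ρ (f x) (g v))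
    (t : UniversalEnvelopingAlgebra R G ⊗[R] V) :
    lift f ρ g hg (mk f t) = tensorLift ρ g t := rfl

theorem lift_tmul_one (f : H →ₗ⁅R⁆ G) (ρ : G →ₗ⁅R⁆ Module.End R N) (g : V →ₗ[R] N)
    (hg : ∀ (x : H) (v : V), g ⁅x, v⁆ = ρ (f x) (g v)) (v : V) :
    lift f ρ g hg (tmul V f 1 v) = g v := by
  rw [tmul_eq_mk, lift_mk, tensorLift_tmul, map_one, Module.End.one_apply]

theorem lift_lie (f : H →ₗ⁅R⁆ G) (ρ : G →ₗ⁅R⁆ Module.End R N) (g : V →ₗ[R] N)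
    (hg : ∀ (x : H) (v : V), g ⁅x, v⁆ = ρ (f x) (g v)) (x : G) (w : InducedModule V f) :
    lift f ρ g hg ⁅x, w⁆ = ρ x (lift f ρ g hg w) := by
  obtain ⟨t, rfl⟩ := mk_surjective f w
  rw [lie_def, lift_mk, ← map_smul (mk f), lift_mk, tensorLift_smul]
  exact congrFun (congrArg DFunLike.coe (UniversalEnvelopingAlgebra.lift_ι_apply' R ρ x)) _

/-- The linear map `v ↦ 1 ⊗ v`. -/
def tmulOne (f : H →ₗ⁅R⁆ G) : V →ₗ[R] InducedModule V f :=
  (mk f).restrictScalars R ∘ₗ TensorProduct.mk R (UniversalEnvelopingAlgebra R G) V 1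

theorem tmulOne_apply (f : H →ₗ⁅R⁆ G) (v : V) : tmulOne f v = tmul V f 1 v := rfl

theorem lie_tmulOne (f : H →ₗ⁅R⁆ G) (x : H) (v : V) :
    ⁅f x, tmulOne f v⁆ = tmulOne f ⁅x, v⁆ := by
  rw [tmulOne_apply, tmulOne_apply, lie_tmul, mul_one, ← envelopingMap_ι f x, ← one_mul (envelopingMap f _), tmul_balanced,
    envelopingAction_ι]

/-- A submodule of an induced module that contains all `1 ⊗ v` and is stable under `G` is
everything. -/
theorem eq_top_of_lie_mem (f : H →ₗ⁅R⁆ G) (P : Submodule R (InducedModule V f))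
    (h1 : ∀ v, tmul V f 1 v ∈ P) (hP : ∀ (x : G), ∀ w ∈ P, ⁅x, w⁆ ∈ P) : P = ⊤ := by
  let S : Subalgebra R (UniversalEnvelopingAlgebra R G) :=
    { carrier := {u | ∀ w ∈ P, u • w ∈ P}
      mul_mem' := by
        intro a b ha hb w hw
        rw [mul_smul]
        exact ha _ (hb _ hw)
      add_mem' := by
        intro a b ha hb w hw
        rw [add_smul]
        exact add_mem (ha _ hw) (hb _ hw)
      algebraMap_mem' := by
        intro r w hw
        rw [algebraMap_smul]
        exact P.smul_mem r hw }
  have hS : ∀ u, u ∈ S := UniversalEnvelopingAlgebra.mem_of_ι_mem S hP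
  refine eq_top_iff.mpr fun w _ => ?_
  obtain ⟨t, rfl⟩ := mk_surjective f w
  induction t using TensorProduct.induction_on with
  | zero => rw [map_zero]; exact P.zero_mem
  | add x y hx hy => rw [map_add]; exact add_mem (hx trivial) (hy trivial)
  | tmul u v =>
    have := hS u _ (h1 v)
    rwa [tmul_eq_mk, ← map_smul, TensorProduct.smul_tmul', smul_eq_mul, mul_one] at this

end InducedModule

/-! ### The elements `l k` of `𝔟` -/

namespace Virasoro

theorem lie_l_l_natCast (i j : ℕ) : ⁅l i, l j⁆ = ((j : ℂ) - i) • l (i + j : ℕ) := by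
  rw [lie_l_l]
  push_cast
  rw [add_eq_left]
  split_ifs with h
  -- The central term can occur only for `i = j = 0`, where `i ^ 3 - i` vanishes.
  · obtain rfl : i = 0 := by omega
    simp
  · exact zero_smul _ _

theorem borel_le_span {x : Virasoro} (hx : x ∈ borel) :
    x ∈ Submodule.span ℂ (Set.range fun k : ℕ => l k) := by
  let B : LieSubalgebra ℂ Virasoro :=
    { toSubmodule := Submodule.span ℂ (Set.range fun k : ℕ => l k)
      lie_mem' := by
        intro x y hx hy
        change bracketBilin x y ∈ Submodule.span ℂ (Set.range fun k : ℕ => l k)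
        induction hx, hy using Submodule.span_induction₂ with
        | mem_mem x y hx hy =>
          obtain ⟨i, rfl⟩ := hx
          obtain ⟨j, rfl⟩ := hy
          have := lie_l_l_natCast i j
          change bracketBilin (l i) (l j) = _ at this
          rw [this]
          exact Submodule.smul_mem _ _ (Submodule.subset_span ⟨i + j, rfl⟩)
        | zero_left y hy => simp
        | zero_right x hx => simp
        | add_left x y w _ _ _ h1 h2 => rw [map_add, LinearMap.add_apply]; exact add_mem h1 h2
        | add_right x y w _ _ _ h1 h2 => rw [map_add]; exact add_mem h1 h2
        | smul_left t x y _ _ h =>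
          rw [map_smul, LinearMap.smul_apply]; exact Submodule.smul_mem _ _ h
        | smul_right t x y _ _ h => rw [map_smul]; exact Submodule.smul_mem _ _ h }
  have hB : borel ≤ B := by
    refine LieSubalgebra.lieSpan_le.mpr ?_
    rintro y (rfl | hy)
    · exact Submodule.subset_span ⟨0, rfl⟩
    · refine (Submodule.span_le (p := B.toSubmodule)).mpr ?_ hy
      rintro _ ⟨i, hi, rfl⟩
      exact Submodule.subset_span ⟨i.toNat, by simp [Int.toNat_of_nonneg (zero_le_one.trans hi)]⟩
  exact hB hx

theorem l_mem_positivePart {k : ℕ} (hk : 1 ≤ k) : l k ∈ positivePart :=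
  Submodule.subset_span ⟨k, by omega, rfl⟩

theorem l_mem_borel (k : ℕ) : l k ∈ borel := by
  rcases Nat.eq_zero_or_pos k with rfl | hk
  · exact LieSubalgebra.subset_lieSpan (Set.mem_insert _ _)
  · exact positivePart_le_borel (l_mem_positivePart hk)

/-- The element `l k` of `𝔟`. -/
def lBorel (k : ℕ) : borel := ⟨l k, l_mem_borel k⟩

theorem span_lBorel : Submodule.span ℂ (Set.range lBorel) = ⊤ := by
  refine eq_top_iff.mpr fun x _ => ?_
  have h : (x : Virasoro) ∈ (Submodule.span ℂ (Set.range lBorel)).map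
      borel.toSubmodule.subtype := by
    rw [Submodule.map_span, ← Set.range_comp]
    exact borel_le_span x.2
  obtain ⟨y, hy, hyx⟩ := h
  exact Subtype.ext hyx ▸ hy

theorem lie_lBorel (i j : ℕ) : ⁅lBorel i, lBorel j⁆ = ((j : ℂ) - i) • lBorel (i + j) :=
  Subtype.ext (lie_l_l_natCast i j)

-- Representations of `𝔟` given by operators

attribute [local instance 100] LieRing.ofAssociativeRing

section

variable {N : Type*} [AddCommGroup N] [Module ℂ N]

/-- The linear map on the Virasoro algebra with `l k ↦ L k` for `k ≥ 0`. -/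
def borelLin (L : ℕ → Module.End ℂ N) : Virasoro →ₗ[ℂ] Module.End ℂ N :=
  -- The values at `c` and at negative indices are arbitrary: `𝔟` is spanned by the `l k` with `k ≥
  -- 0`.
  basis.constr ℂ fun a => a.elim 0 fun i => L i.toNat

theorem borelLin_l (L : ℕ → Module.End ℂ N) (k : ℕ) : borelLin L (l k) = L k := by
  rw [borelLin, l, Module.Basis.constr_basis]
  rfl

theorem borelLin_bracket (L : ℕ → Module.End ℂ N)
    (hL : ∀ i j, L i * L j - L j * L i = ((j : ℂ) - i) • L (i + j)) {x y : Virasoro}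
    (hx : x ∈ borel) (hy : y ∈ borel) :
    borelLin L (bracketBilin x y) = borelLin L x * borelLin L y - borelLin L y * borelLin L x := by
  have hx' := borel_le_span hx
  have hy' := borel_le_span hy
  clear hx hy
  induction hx', hy' using Submodule.span_induction₂ with
  | mem_mem x y hx hy =>
    obtain ⟨i, rfl⟩ := hx
    obtain ⟨j, rfl⟩ := hy
    have := lie_l_l_natCast i j
    change bracketBilin (l i) (l j) = _ at this
    rw [this, map_smul, borelLin_l, borelLin_l, borelLin_l, hL]
  | zero_left y hy => simp
  | zero_right x hx => simp
  | add_left x y w _ _ _ h1 h2 =>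
    simp only [map_add, LinearMap.add_apply, h1, h2, add_mul, mul_add]; abel
  | add_right x y w _ _ _ h1 h2 => simp only [map_add, h1, h2, add_mul, mul_add]; abel
  | smul_left t x y _ _ h =>
    simp only [map_smul, LinearMap.smul_apply, h, smul_mul_assoc, mul_smul_comm, smul_sub]
  | smul_right t x y _ _ h =>
    simp only [map_smul, h, smul_mul_assoc, mul_smul_comm, smul_sub]

/-- A representation of `𝔟` from a family of operators with the commutation relations of the
`l k`. -/
def borelRep (L : ℕ → Module.End ℂ N)
    (hL : ∀ i j, L i * L j - L j * L i = ((j : ℂ) - i) • L (i + j)) :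
    borel →ₗ⁅ℂ⁆ Module.End ℂ N :=
  { borelLin L ∘ₗ borel.toSubmodule.subtype with
    map_lie' := by
      intro x y
      exact borelLin_bracket L hL x.2 y.2 }

end

/-! ### Ordered monomials in `l 0` and `l 1` -/

section Monomials

variable {N : Type*} [AddCommGroup N] [Module ℂ N]

/-- The vectors obtained from `x` by applying polynomials in `L₁`. -/
def applyPoly (L₁ : Module.End ℂ N) (x : N) : ℂ[X] →ₗ[ℂ] N :=
  LinearMap.applyₗ x ∘ₗ (aeval L₁).toLinearMap

theorem applyPoly_apply (L₁ : Module.End ℂ N) (x : N) (q : ℂ[X]) :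
    applyPoly L₁ x q = aeval L₁ q x := rfl

theorem applyPoly_X_mul (L₁ : Module.End ℂ N) (x : N) (q : ℂ[X]) :
    applyPoly L₁ x (X * q) = L₁ (applyPoly L₁ x q) := by
  rw [applyPoly_apply, map_mul, aeval_X, Module.End.mul_apply, applyPoly_apply]

/-- The vectors obtained from `x` by applying polynomials in `L₁` and then in `L₀`. -/
def applyPoly₂ (L₀ L₁ : Module.End ℂ N) (x : N) : ℂ[X][X] →ₗ[ℂ] N :=
  Polynomial.lsum fun j => (L₀ ^ j) ∘ₗ applyPoly L₁ x

theorem applyPoly₂_apply (L₀ L₁ : Module.End ℂ N) (x : N) (p : ℂ[X][X]) :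
    applyPoly₂ L₀ L₁ x p = p.sum fun j q => (L₀ ^ j) (applyPoly L₁ x q) := rfl

theorem applyPoly₂_monomial (L₀ L₁ : Module.End ℂ N) (x : N) (j : ℕ) (q : ℂ[X]) :
    applyPoly₂ L₀ L₁ x (monomial j q) = (L₀ ^ j) (applyPoly L₁ x q) := by
  rw [applyPoly₂_apply, sum_monomial_index]
  simp

theorem map_applyPoly₂ {N' : Type*} [AddCommGroup N'] [Module ℂ N'] (φ : N →ₗ[ℂ] N')
    {L₀ L₁ : Module.End ℂ N} {L₀' L₁' : Module.End ℂ N'} (h₀ : ∀ w, φ (L₀ w) = L₀' (φ w))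
    (h₁ : ∀ w, φ (L₁ w) = L₁' (φ w)) (x : N) (p : ℂ[X][X]) :
    φ (applyPoly₂ L₀ L₁ x p) = applyPoly₂ L₀' L₁' (φ x) p := by
  have hpow (j : ℕ) (w : N) : φ ((L₀ ^ j) w) = (L₀' ^ j) (φ w) := by
    induction j with
    | zero => simp
    | succ j ih => rw [pow_succ', pow_succ', Module.End.mul_apply, Module.End.mul_apply, h₀, ih]
  have hpoly (q : ℂ[X]) : φ (applyPoly L₁ x q) = applyPoly L₁' (φ x) q := by
    induction q using Polynomial.induction_on with
    | C t => simp [applyPoly_apply]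
    | add p q hp hq => simp only [map_add, hp, hq]
    | monomial n t ih =>
      rw [show (C t * X ^ (n + 1) : ℂ[X]) = X * (C t * X ^ n) by ring, applyPoly_X_mul,
        applyPoly_X_mul, h₁, ih]
  induction p using Polynomial.induction_on' with
  | add p q hp hq => simp only [map_add, hp, hq]
  | monomial j q => rw [applyPoly₂_monomial, applyPoly₂_monomial, hpow, hpoly]

variable {L : ℕ → Module.End ℂ N} {x : N}

theorem apply_mem_range_applyPoly (hL : ∀ i j, L i * L j - L j * L i = ((j : ℂ) - i) • L (i + j))
    (hx : ∀ k, 2 ≤ k → L k x ∈ LinearMap.range (applyPoly (L 1) x)) {k : ℕ} (hk : 1 ≤ k) {v : N}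
    (hv : v ∈ LinearMap.range (applyPoly (L 1) x)) :
    L k v ∈ LinearMap.range (applyPoly (L 1) x) := by
  have h1 : ∀ w ∈ LinearMap.range (applyPoly (L 1) x),
      L 1 w ∈ LinearMap.range (applyPoly (L 1) x) := by
    rintro _ ⟨q, rfl⟩
    exact ⟨X * q, applyPoly_X_mul _ _ _⟩
  obtain ⟨q, rfl⟩ := hv
  -- Moving `L k` past `L 1` produces a multiple of `L (k + 1)`, so the index must vary.
  induction q using Polynomial.induction_on generalizing k with
  | C t =>
    have e : applyPoly (L 1) x (C t) = t • x := by simp [applyPoly_apply]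
    rw [e, map_smul]
    refine Submodule.smul_mem _ _ ?_
    rcases hk.eq_or_lt with rfl | hk
    · exact ⟨X, by simp [applyPoly_apply]⟩
    · exact hx k hk
  | add p q hp hq => simp only [map_add]; exact add_mem (hp hk) (hq hk)
  | monomial n t ih =>
    rw [show (C t * X ^ (n + 1) : ℂ[X]) = X * (C t * X ^ n) by ring, applyPoly_X_mul]
    have h := LinearMap.congr_fun (hL k 1) (applyPoly (L 1) x (C t * X ^ n))
    simp only [LinearMap.sub_apply, Module.End.mul_apply, LinearMap.smul_apply] at h
    rw [sub_eq_iff_eq_add.mp h]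
    exact add_mem (Submodule.smul_mem _ _ (ih (by omega))) (h1 _ (ih hk))

/-- Moving `L k` past `L 0` reproduces a multiple of `L k`, so induction on the power of `L 0`
reduces to polynomials in `L 1` alone. -/
theorem apply_mem_range_applyPoly₂ (hL : ∀ i j, L i * L j - L j * L i = ((j : ℂ) - i) • L (i + j))
    (hx : ∀ k, 2 ≤ k → L k x ∈ LinearMap.range (applyPoly (L 1) x)) (k : ℕ) {v : N}
    (hv : v ∈ LinearMap.range (applyPoly₂ (L 0) (L 1) x)) :
    L k v ∈ LinearMap.range (applyPoly₂ (L 0) (L 1) x) := by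
  have h0 : ∀ w ∈ LinearMap.range (applyPoly₂ (L 0) (L 1) x),
      L 0 w ∈ LinearMap.range (applyPoly₂ (L 0) (L 1) x) := by
    rintro _ ⟨p, rfl⟩
    induction p using Polynomial.induction_on' with
    | add p q hp hq => simp only [map_add]; exact add_mem hp hq
    | monomial j q =>
      exact ⟨monomial (j + 1) q, by
        rw [applyPoly₂_monomial, applyPoly₂_monomial, pow_succ', Module.End.mul_apply]⟩
  rcases Nat.eq_zero_or_pos k with rfl | hk
  · exact h0 v hv
  obtain ⟨p, rfl⟩ := hv
  induction p using Polynomial.induction_on' with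
  | add p q hp hq => simp only [map_add]; exact add_mem hp hq
  | monomial j q =>
    rw [applyPoly₂_monomial]
    induction j with
    | zero =>
      obtain ⟨r, hr⟩ := apply_mem_range_applyPoly hL hx hk ⟨q, rfl⟩
      exact ⟨monomial 0 r, by rw [applyPoly₂_monomial, pow_zero, Module.End.one_apply, hr]; rfl⟩
    | succ j ih =>
      have h := LinearMap.congr_fun (hL k 0) ((L 0 ^ j) (applyPoly (L 1) x q))
      simp only [LinearMap.sub_apply, Module.End.mul_apply, LinearMap.smul_apply] at h
      rw [pow_succ', Module.End.mul_apply, sub_eq_iff_eq_add.mp h]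
      exact add_mem (Submodule.smul_mem _ _ ih) (h0 _ ih)

end Monomials

namespace Model

/-! ### Linear independence of the ordered monomials in the model -/

section Independence

variable {S : Type*} [CommRing S] [Algebra ℂ S] {s : S} {σ : S →ₐ[ℂ] S} {z c a b : ℂ}

theorem lOp_zero_apply (w : S[X]) :
    lOp s σ z c a b 0 w = c • w - X * (z • w + derivative w) + C s * w := by
  simp [lOp, densityOp_apply, whittakerOp, mulC_apply, mulY_apply, dZ_apply]

theorem lOp_one_apply (w : S[X]) :
    lOp s σ z c a b 1 w = (2 * c) • (z • w + derivative w) -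
      X * (z • (z • w + derivative w) + derivative (z • w + derivative w)) +
        a • w.map σ.toRingHom := by
  have hd : derivative (X ^ (1 + 1) : ℂ[X]) = (2 : ℂ) • X := by
    rw [derivative_X_pow, smul_eq_C_mul]
    norm_num
  rw [lOp, densityOp_apply, hd, map_smul, map_pow, aeval_X, smul_smul, mul_comm c]
  simp only [LinearMap.add_apply, LinearMap.sub_apply, LinearMap.smul_apply, Module.End.mul_apply,
    pow_succ, pow_zero, one_mul, dZ_apply, mulY_apply, whittakerOp, mapS_apply]

/-- The operator `l 1` on the polynomials in `y` with constant coefficients. -/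
def lOneOp (z c a : ℂ) : Module.End ℂ ℂ[X] := lOp (S := ℂ) 0 (AlgHom.id ℂ ℂ) z c a 0 1

theorem lOneOp_apply (r : ℂ[X]) :
    lOneOp z c a r = (2 * c) • (z • r + derivative r) -
      X * (z • (z • r + derivative r) + derivative (z • r + derivative r)) + a • r := by
  rw [lOneOp, lOp_one_apply]
  congr
  exact Polynomial.map_id

/-- `l 1` involves the coefficient algebra only through `σ`, which fixes `ℂ`. -/
theorem lOp_one_map (r : ℂ[X]) : lOp s σ z c a b 1 (r.map (algebraMap ℂ S)) =
    (lOneOp z c a r).map (algebraMap ℂ S) := by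
  have hσ : σ.toRingHom.comp (algebraMap ℂ S) = algebraMap ℂ S := σ.comp_algebraMap
  have hm (t : ℂ) (p : ℂ[X]) : (t • p).map (algebraMap ℂ S) = t • p.map (algebraMap ℂ S) := by
    rw [smul_eq_C_mul, Polynomial.map_mul, map_C, Algebra.smul_def, Polynomial.algebraMap_apply]
  rw [lOp_one_apply, lOneOp_apply, Polynomial.map_map, hσ]
  simp only [hm, Polynomial.map_add, Polynomial.map_sub, Polynomial.map_mul, Polynomial.map_X,
    derivative_map, derivative_add, derivative_smul]

theorem applyPoly_lOp_one (q : ℂ[X]) : applyPoly (lOp s σ z c a b 1) 1 q =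
    (applyPoly (lOneOp z c a) 1 q).map (algebraMap ℂ S) := by
  induction q using Polynomial.induction_on with
  | C t => simp [applyPoly_apply, Algebra.smul_def, Polynomial.algebraMap_apply]
  | add p q hp hq => simp only [map_add, Polynomial.map_add, hp, hq]
  | monomial n t ih =>
    rw [show (C t * X ^ (n + 1) : ℂ[X]) = X * (C t * X ^ n) by ring, applyPoly_X_mul,
      applyPoly_X_mul, ih, lOp_one_map]

theorem natDegree_lOneOp_le {r : ℂ[X]} {n : ℕ} (hr : r.natDegree ≤ n) :
    (lOneOp z c a r).natDegree ≤ n + 1 := by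
  have hd {p : ℂ[X]} (hp : p.natDegree ≤ n) : (derivative p).natDegree ≤ n :=
    (natDegree_derivative_le p).trans (by omega)
  have ht {p : ℂ[X]} (hp : p.natDegree ≤ n) : (z • p + derivative p).natDegree ≤ n :=
    natDegree_add_le_of_degree_le ((natDegree_smul_le _ _).trans hp) (hd hp)
  rw [lOneOp_apply]
  refine natDegree_add_le_of_degree_le 
    ((natDegree_sub_le _ _).trans (max_le ?_ ?_)) ?_
  · exact ((natDegree_smul_le _ _).trans (ht hr)).trans (by omega)
  · refine natDegree_mul_le.trans ?_
    rw [natDegree_X, add_comm]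
    exact Nat.succ_le_succ (ht (ht hr))
  · exact ((natDegree_smul_le _ _).trans hr).trans (by omega)

theorem coeff_lOneOp {r : ℂ[X]} {n : ℕ} (hr : r.natDegree ≤ n) :
    (lOneOp z c a r).coeff (n + 1) = -z ^ 2 * r.coeff n := by
  have h (m : ℕ) (hm : n < m) : r.coeff m = 0 := coeff_eq_zero_of_natDegree_lt (by omega)
  rw [lOneOp_apply]
  simp only [coeff_add, coeff_sub, coeff_smul, coeff_X_mul, coeff_derivative, derivative_add,
    derivative_smul, h (n + 1) (by omega), h (n + 1 + 1) (by omega), smul_eq_mul]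
  ring

/-- Triangularity: `l 1 ^ n` applied to `1` has degree `n` in `y` with leading coefficient `(-z ^ 2)
^ n`. -/
theorem applyPoly_lOneOp_ne_zero (hz : z ≠ 0) {q : ℂ[X]} (hq : q ≠ 0) :
    applyPoly (lOneOp z c a) 1 q ≠ 0 := by
  have hmono (n : ℕ) : ((lOneOp z c a ^ n) 1).natDegree ≤ n ∧
      ((lOneOp z c a ^ n) 1).coeff n = (-z ^ 2) ^ n := by
    induction n with
    | zero => simp
    | succ n ih =>
      rw [pow_succ', Module.End.mul_apply]
      exact ⟨natDegree_lOneOp_le ih.1, by rw [coeff_lOneOp ih.1, ih.2, pow_succ' (-z ^ 2)]⟩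
  intro h0
  have h := congrArg (fun p => p.coeff q.natDegree) h0
  simp only [applyPoly_apply, aeval_eq_sum_range, LinearMap.sum_apply, LinearMap.smul_apply,
    finsetSum_coeff, coeff_smul, coeff_zero] at h
  rw [Finset.sum_range_succ, Finset.sum_eq_zero, zero_add, (hmono _).2] at h
  · exact mul_ne_zero (leadingCoeff_ne_zero.mpr hq)
      (pow_ne_zero _ (neg_ne_zero.mpr (pow_ne_zero 2 hz))) h
  · intro i hi
    rw [coeff_eq_zero_of_natDegree_lt ((hmono i).1.trans_lt (Finset.mem_range.mp hi)), smul_zero]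

/-- Here `κ k` plays the role of the coefficient of `s ^ k`. Apart from multiplication by `s`, the
operator `l 0` does not raise the degree in `s`, so the top term of `l 0 ^ j` is `s ^ j`. -/
theorem coeff_lOp_zero_pow {κ : ℕ → S →ₗ[ℂ] ℂ} (h₀ : κ 0 1 = 1) (h₁ : ∀ k, κ (k + 1) 1 = 0)
    (hs : ∀ k x, κ (k + 1) (s * x) = κ k x) (r : ℂ[X]) (j i : ℕ) :
    κ j (((lOp s σ z c a b 0 ^ j) (r.map (algebraMap ℂ S))).coeff i) = r.coeff i ∧
      ∀ k, j < k → κ k (((lOp s σ z c a b 0 ^ j) (r.map (algebraMap ℂ S))).coeff i) = 0 := by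
  induction j generalizing i with
  | zero =>
    rw [pow_zero, Module.End.one_apply, coeff_map, Algebra.algebraMap_eq_smul_one]
    refine ⟨by rw [map_smul, h₀, smul_eq_mul, mul_one], fun k hk => ?_⟩
    obtain ⟨k, rfl⟩ : ∃ k', k = k' + 1 := ⟨k - 1, by omega⟩
    rw [map_smul, h₁, smul_zero]
  | succ j ih =>
    rw [pow_succ', Module.End.mul_apply, lOp_zero_apply]
    set w := (lOp s σ z c a b 0 ^ j) (r.map (algebraMap ℂ S))
    have key (k : ℕ) (hk : j ≤ k) :
        κ (k + 1) ((c • w - X * (z • w + derivative w) + C s * w).coeff i) = κ k (w.coeff i) := by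
      have hv (m : ℕ) : κ (k + 1) (w.coeff m) = 0 := (ih m).2 _ (by omega)
      have hX : κ (k + 1) ((X * (z • w + derivative w)).coeff i) = 0 := by
        rcases i with _ | i
        · rw [coeff_X_mul_zero, map_zero]
        · have e : (w.coeff (i + 1) * ((i : S) + 1)) = ((i : ℂ) + 1) • w.coeff (i + 1) := by
            rw [Algebra.smul_def, map_add, map_natCast, map_one, mul_comm]
          rw [coeff_X_mul, coeff_add, coeff_smul, coeff_derivative, e, map_add, map_smul,
            map_smul, hv, hv, smul_zero, smul_zero, add_zero]
      rw [coeff_add, coeff_sub, coeff_smul, coeff_C_mul, map_add, map_sub, map_smul, hv, hX, hs,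
        smul_zero, sub_zero, zero_add]
    refine ⟨by rw [key j le_rfl, (ih i).1], fun k hk => ?_⟩
    obtain ⟨k, rfl⟩ : ∃ k', k = k' + 1 := ⟨k - 1, by omega⟩
    rw [key k (by omega), (ih i).2 k (by omega)]

/-- The functional `κ` at the degree of `p` in `l 0` isolates the leading coefficient of `p`, a
nonzero polynomial in `l 1` applied to `1`. -/
theorem applyPoly₂_lOp_injective (hz : z ≠ 0) {κ : ℕ → S →ₗ[ℂ] ℂ} (h₀ : κ 0 1 = 1)
    (h₁ : ∀ k, κ (k + 1) 1 = 0) (hs : ∀ k x, κ (k + 1) (s * x) = κ k x) :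
    Function.Injective (applyPoly₂ (lOp s σ z c a b 0) (lOp s σ z c a b 1) 1) := by
  rw [injective_iff_map_eq_zero]
  intro p hp
  by_contra hne
  refine applyPoly_lOneOp_ne_zero (c := c) (a := a) hz (leadingCoeff_ne_zero.mpr hne) ?_
  ext i
  rw [applyPoly₂_apply, sum_over_range' p (by simp) (p.natDegree + 1) (Nat.lt_succ_self _)] at hp
  have h := congrArg (fun w => κ p.natDegree (coeff w i)) hp
  simp only [finsetSum_coeff, map_sum, coeff_zero, map_zero, applyPoly_lOp_one] at h
  rw [Finset.sum_range_succ, Finset.sum_eq_zero, zero_add,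
    (coeff_lOp_zero_pow h₀ h₁ hs _ _ _).1] at h
  · exact h
  · intro j hj
    exact (coeff_lOp_zero_pow h₀ h₁ hs _ _ _).2 _ (Finset.mem_range.mp hj)

end Independence

end Model

section

attribute [local instance 100] LieRing.ofAssociativeRing

/-! ### The comparison map from `W_𝐦` to the model -/

/-- The density weight of the model of `W_𝐦`. -/
def weightParam (z m₃ m₄ : ℂ) : ℂ := (m₄ - z * m₃) / z ^ 4

/-- The scalar by which `l 1` acts on the Whittaker vector of the model of `W_𝐦`. -/
def whittakerParam₁ (z m₃ m₄ : ℂ) : ℂ := 2 * z * weightParam z m₃ m₄ - m₃ / z ^ 2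

/-- The scalar by which `l 2` acts on the Whittaker vector of the model of `W_𝐦`. -/
def whittakerParam₂ (z m₂ m₃ m₄ : ℂ) : ℂ :=
  m₂ - weightParam z m₃ m₄ * z ^ 2 + z * whittakerParam₁ z m₃ m₄

/-- The right side is the scalar by which `l (k + 2) - z ^ (k + 1) l 1` acts on `1` in the model.
The indices 2, 3, 4 determine the three parameters, and the formula for `m_k` with `k > 4` is then
automatic. -/
theorem mCoeff_eq {z m₂ m₃ m₄ : ℂ} (hz : z ≠ 0) (k : ℕ) :
    mCoeff z m₂ m₃ m₄ (k + 2) = weightParam z m₃ m₄ * (k + 1) * z ^ (k + 2) -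
      z ^ (k + 1) * whittakerParam₁ z m₃ m₄ +
        if k = 0 then whittakerParam₂ z m₂ m₃ m₄ else 0 := by
  match k with
  | 0 =>
    simp only [mCoeff, whittakerParam₂]
    norm_num
  | 1 =>
    simp only [mCoeff, whittakerParam₁, weightParam]
    norm_num
    field_simp
    ring
  | 2 =>
    simp only [mCoeff, whittakerParam₁, weightParam]
    norm_num
    field_simp
    ring
  | k + 3 =>
    rw [mCoeff, if_neg (by omega), if_neg (by omega), if_neg (by omega), if_neg (by omega),
      if_neg (by omega), show k + 3 + 2 - 3 = k + 2 by omega, show k + 3 + 2 - 4 = k + 1 by omega,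
      whittakerParam₁, weightParam]
    push_cast
    field_simp
    ring

section

variable {S : Type*} [CommRing S] [Algebra ℂ S] {s : S} {σ : S →ₐ[ℂ] S} {z m₂ m₃ m₄ : ℂ}

/-- The action of `l k` on the model of `W_𝐦`. -/
abbrev modelOp (s : S) (σ : S →ₐ[ℂ] S) (z m₂ m₃ m₄ : ℂ) : ℕ → Module.End ℂ S[X] :=
  Model.lOp s σ z (weightParam z m₃ m₄) (whittakerParam₁ z m₃ m₄) (whittakerParam₂ z m₂ m₃ m₄)

theorem lOp_succ_one (z c a b : ℂ) (k : ℕ) :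
    Model.lOp s σ z c a b (k + 1) 1 = (c * ((k + 2 : ℕ) * z ^ (k + 1)) +
      if k = 0 then a else if k = 1 then b else 0) • (1 : S[X]) - z ^ (k + 2) • X := by
  rw [Model.lOp, LinearMap.add_apply, ← C_1, Model.densityOp_C, C_1, mul_one, add_smul,
    sub_add_eq_add_sub]
  congr 2
  match k with
  | 0 => simp [Model.whittakerOp, Model.mapS_apply]
  | 1 => simp [Model.whittakerOp, Model.mapS_apply]
  | k + 2 => simp [Model.whittakerOp]

theorem borelLin_lHat (hz : z ≠ 0) {k : ℕ} (hk : 2 ≤ k) :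
    borelLin (modelOp s σ z m₂ m₃ m₄) (lHat z k) 1 = mCoeff z m₂ m₃ m₄ k • 1 := by
  obtain ⟨k, rfl⟩ : ∃ k', k = k' + 2 := ⟨k - 2, by omega⟩
  have h1 := borelLin_l (modelOp s σ z m₂ m₃ m₄) 1
  rw [Nat.cast_one] at h1
  rw [lHat, map_sub, map_smul, borelLin_l, h1, LinearMap.sub_apply, LinearMap.smul_apply,
    lOp_succ_one, lOp_succ_one _ _ _ _ 0, mCoeff_eq hz, show k + 2 - 1 = k + 1 by omega,
    if_neg k.succ_ne_zero]
  simp only [Nat.add_eq_right, if_true]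
  push_cast
  module

theorem borelLin_aSub (hz : z ≠ 0) {x : Virasoro} (hx : x ∈ aSub z) :
    borelLin (modelOp s σ z m₂ m₃ m₄) x 1 = mForm z m₂ m₃ m₄ x • 1 := by
  change x ∈ Submodule.span ℂ {x | ∃ k : ℕ, 2 ≤ k ∧ x = lHat z k} at hx
  induction hx using Submodule.span_induction with
  | mem x hx =>
    obtain ⟨k, hk, rfl⟩ := hx
    rw [borelLin_lHat hz hk, mForm_lHat]
  | zero => simp
  | add x y _ _ hx hy => rw [map_add, map_add, LinearMap.add_apply, hx, hy, add_smul]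
  | smul t x _ hx => rw [map_smul, map_smul, LinearMap.smul_apply, hx, smul_assoc]

/-- The linear map `ℂ_𝐦 → S[X]` sending the generator to `1`. -/
def CMod.toModel (S : Type*) [CommRing S] [Algebra ℂ S] (z m₂ m₃ m₄ : ℂ) :
    CMod z m₂ m₃ m₄ →ₗ[ℂ] S[X] :=
  LinearMap.toSpanSingleton ℂ S[X] 1

theorem CMod.toModel_lie (hz : z ≠ 0) (hσ : σ s = s - 1) (x : aSub z) (w : CMod z m₂ m₃ m₄) :
    CMod.toModel S z m₂ m₃ m₄ ⁅x, w⁆ =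
      ((borelRep (modelOp s σ z m₂ m₃ m₄) (Model.lOp_commutator hσ _ _ _ _)).comp
        (LieSubalgebra.inclusion positivePart_le_borel))
          (LieSubalgebra.inclusion (aSub_le_positivePart z) x) (CMod.toModel S z m₂ m₃ m₄ w) := by
  have hw : CMod.toModel S z m₂ m₃ m₄ w = (show ℂ from w) • (1 : S[X]) := rfl
  have h := borelLin_aSub (s := s) (σ := σ) (m₂ := m₂) (m₃ := m₃) (m₄ := m₄) hz x.2
  rw [CMod.lie_def, map_smul, hw, map_smul]
  change _ = (show ℂ from w) • borelLin (modelOp s σ z m₂ m₃ m₄) x 1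
  rw [h, smul_comm]

/-- The comparison map from `V_𝐦` to the model of `W_𝐦`. -/
def VMod.toModel (hz : z ≠ 0) (hσ : σ s = s - 1) : VMod z m₂ m₃ m₄ →ₗ[ℂ] S[X] :=
  InducedModule.lift _ _ _ (CMod.toModel_lie hz hσ)

theorem VMod.toModel_lie (hz : z ≠ 0) (hσ : σ s = s - 1) (x : positivePart)
    (v : VMod z m₂ m₃ m₄) : VMod.toModel hz hσ ⁅x, v⁆ =
      borelRep (modelOp s σ z m₂ m₃ m₄) (Model.lOp_commutator hσ _ _ _ _)
        (LieSubalgebra.inclusion positivePart_le_borel x) (VMod.toModel hz hσ v) :=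
  InducedModule.lift_lie _ _ _ (CMod.toModel_lie hz hσ) x v

/-- The comparison map from `W_𝐦` to its model. -/
def WMod.toModel (hz : z ≠ 0) (hσ : σ s = s - 1) : WMod z m₂ m₃ m₄ →ₗ[ℂ] S[X] :=
  InducedModule.lift _ _ _ (VMod.toModel_lie hz hσ)

/-- The canonical generator of `V_𝐦`. -/
def VMod.gen (z m₂ m₃ m₄ : ℂ) : VMod z m₂ m₃ m₄ :=
  InducedModule.tmul _ _ 1 (CMod.one z m₂ m₃ m₄)

/-- The canonical generator of `W_𝐦`. -/
def WMod.gen (z m₂ m₃ m₄ : ℂ) : WMod z m₂ m₃ m₄ :=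
  InducedModule.tmul _ _ 1 (VMod.gen z m₂ m₃ m₄)

theorem WMod.toModel_gen (hz : z ≠ 0) (hσ : σ s = s - 1) :
    WMod.toModel hz hσ (WMod.gen z m₂ m₃ m₄) = 1 := by
  refine (InducedModule.lift_tmul_one _ _ _ (VMod.toModel_lie hz hσ) _).trans ?_
  refine (InducedModule.lift_tmul_one _ _ _ (CMod.toModel_lie hz hσ) _).trans ?_
  exact one_smul ℂ _

/-- The action of `l k` on `W_𝐦`. -/
def WMod.lOp (z m₂ m₃ m₄ : ℂ) (k : ℕ) : Module.End ℂ (WMod z m₂ m₃ m₄) :=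
  LieModule.toEnd ℂ borel _ (lBorel k)

theorem WMod.lOp_commutator (i j : ℕ) :
    WMod.lOp z m₂ m₃ m₄ i * WMod.lOp z m₂ m₃ m₄ j - WMod.lOp z m₂ m₃ m₄ j * WMod.lOp z m₂ m₃ m₄ i =
      ((j : ℂ) - i) • WMod.lOp z m₂ m₃ m₄ (i + j) := by
  rw [WMod.lOp, WMod.lOp, WMod.lOp, ← map_smul, ← lie_lBorel, LieHom.map_lie]
  rfl

theorem WMod.toModel_lOp (hz : z ≠ 0) (hσ : σ s = s - 1) (k : ℕ) (w : WMod z m₂ m₃ m₄) :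
    WMod.toModel hz hσ (WMod.lOp z m₂ m₃ m₄ k w) =
      modelOp s σ z m₂ m₃ m₄ k (WMod.toModel hz hσ w) := by
  refine (InducedModule.lift_lie _ _ _ (VMod.toModel_lie hz hσ) _ _).trans ?_
  exact LinearMap.congr_fun (borelLin_l _ k) _

end

/-! ### Generators of `W_𝐦` and reduction to the model -/

section

variable {z m₂ m₃ m₄ : ℂ}

theorem lie_mem_of_lBorel_mem {P : Submodule ℂ (WMod z m₂ m₃ m₄)}
    (hP : ∀ k, ∀ w ∈ P, ⁅lBorel k, w⁆ ∈ P) (x : borel) {w : WMod z m₂ m₃ m₄} (hw : w ∈ P) :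
    ⁅x, w⁆ ∈ P := by
  have hx : x ∈ Submodule.span ℂ (Set.range lBorel) := span_lBorel ▸ Submodule.mem_top
  induction hx using Submodule.span_induction with
  | mem x hx => obtain ⟨k, rfl⟩ := hx; exact hP k w hw
  | zero => rw [zero_lie]; exact P.zero_mem
  | add x y _ _ hx hy => rw [add_lie]; exact add_mem hx hy
  | smul t x _ hx => rw [smul_lie]; exact P.smul_mem t hx

theorem WMod.lOp_gen {k : ℕ} (hk : 2 ≤ k) : WMod.lOp z m₂ m₃ m₄ k (WMod.gen z m₂ m₃ m₄) =
    z ^ (k - 1) • WMod.lOp z m₂ m₃ m₄ 1 (WMod.gen z m₂ m₃ m₄) +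
      mCoeff z m₂ m₃ m₄ k • WMod.gen z m₂ m₃ m₄ := by
  have h1 := InducedModule.lie_tmulOne (LieSubalgebra.inclusion (aSub_le_positivePart z))
    ⟨lHat z k, lHat_mem_aSub z hk⟩ (CMod.one z m₂ m₃ m₄)
  have h2 := InducedModule.lie_tmulOne (LieSubalgebra.inclusion positivePart_le_borel)
    (LieSubalgebra.inclusion (aSub_le_positivePart z) ⟨lHat z k, lHat_mem_aSub z hk⟩)
    (VMod.gen z m₂ m₃ m₄)
  rw [CMod.lie_lHat _ _ _ _ hk, map_smul] at h1
  have h3 : (LieSubalgebra.inclusion positivePart_le_borel (LieSubalgebra.inclusion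
      (aSub_le_positivePart z) ⟨lHat z k, lHat_mem_aSub z hk⟩)) =
        lBorel k - z ^ (k - 1) • lBorel 1 := rfl
  have h4 : ⁅LieSubalgebra.inclusion (aSub_le_positivePart z) ⟨lHat z k, lHat_mem_aSub z hk⟩,
      VMod.gen z m₂ m₃ m₄⁆ = mCoeff z m₂ m₃ m₄ k • VMod.gen z m₂ m₃ m₄ := h1
  rw [h3, h4, map_smul, sub_lie,
    smul_lie, sub_eq_iff_eq_add'] at h2
  exact h2

/-- Generation is used once for each induction: first for the preimage of `P` in `V_𝐦`, then for `P`
itself. -/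
theorem WMod.eq_top_of_lOp_mem {P : Submodule ℂ (WMod z m₂ m₃ m₄)}
    (hP : ∀ k, ∀ w ∈ P, ⁅lBorel k, w⁆ ∈ P) (hgen : WMod.gen z m₂ m₃ m₄ ∈ P) : P = ⊤ := by
  have hP' : ∀ x : borel, ∀ w ∈ P, ⁅x, w⁆ ∈ P := fun x w hw => lie_mem_of_lBorel_mem hP x hw
  have hQ :
      P.comap (InducedModule.tmulOne (LieSubalgebra.inclusion positivePart_le_borel)) = ⊤ := by
    refine InducedModule.eq_top_of_lie_mem _ _ (fun t => ?_) fun x v hv => ?_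
    · have ht : t = (show ℂ from t) • CMod.one z m₂ m₃ m₄ := (mul_one (show ℂ from t)).symm
      rw [ht, ← InducedModule.tmulOne_apply, map_smul]
      exact Submodule.smul_mem _ _ hgen
    · rw [Submodule.mem_comap] at hv ⊢
      rw [← InducedModule.lie_tmulOne]
      exact hP' _ _ hv
  refine InducedModule.eq_top_of_lie_mem _ _ (fun v => ?_) hP'
  have hv : v ∈ P.comap (InducedModule.tmulOne (LieSubalgebra.inclusion positivePart_le_borel)) :=
    hQ ▸ Submodule.mem_top
  exact hv

theorem WMod.applyPoly₂_surjective : Function.Surjective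
    (applyPoly₂ (WMod.lOp z m₂ m₃ m₄ 0) (WMod.lOp z m₂ m₃ m₄ 1) (WMod.gen z m₂ m₃ m₄)) := by
  rw [← LinearMap.range_eq_top]
  refine WMod.eq_top_of_lOp_mem (fun k w hw => ?_) ⟨monomial 0 1, ?_⟩
  · refine apply_mem_range_applyPoly₂ WMod.lOp_commutator (fun k hk => ?_) k hw
    rw [WMod.lOp_gen hk]
    refine ⟨z ^ (k - 1) • X + mCoeff z m₂ m₃ m₄ k • 1, ?_⟩
    simp [applyPoly_apply]
  · rw [applyPoly₂_monomial]
    simp [applyPoly_apply]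

/-- The comparison map carries the spanning ordered monomials to independent vectors, so it is
injective. Its surjectivity need not be known: the image of any nonzero submodule is already the
whole model. -/
theorem WMod.isIrreducible_of_model {S : Type*} [CommRing S] [IsDomain S] [Algebra ℂ S] {s : S}
    {σ : S →ₐ[ℂ] S} (hσ : σ s = s - 1) {κ : ℕ → S →ₗ[ℂ] ℂ} (h₀ : κ 0 1 = 1)
    (h₁ : ∀ k, κ (k + 1) 1 = 0) (hs : ∀ k x, κ (k + 1) (s * x) = κ k x)
    (hz : z ≠ 0) (hc : weightParam z m₃ m₄ ≠ 0)
    (hS : ∀ J : Submodule ℂ S, (∀ p ∈ J, s * p ∈ J) →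
      (∀ p ∈ J, whittakerParam₁ z m₃ m₄ • σ p ∈ J) →
      (∀ p ∈ J, whittakerParam₂ z m₂ m₃ m₄ • σ (σ p) ∈ J) → J ≠ ⊥ → J = ⊤) :
    LieModule.IsIrreducible ℂ borel (WMod z m₂ m₃ m₄) := by
  set φ : WMod z m₂ m₃ m₄ →ₗ[ℂ] S[X] := WMod.toModel hz hσ with hφ
  have hcomp : φ ∘ (applyPoly₂ (WMod.lOp z m₂ m₃ m₄ 0) (WMod.lOp z m₂ m₃ m₄ 1)
      (WMod.gen z m₂ m₃ m₄)) =
        applyPoly₂ (modelOp s σ z m₂ m₃ m₄ 0) (modelOp s σ z m₂ m₃ m₄ 1) 1 := by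
    ext1 p
    rw [Function.comp_apply, map_applyPoly₂ φ (WMod.toModel_lOp hz hσ 0)
      (WMod.toModel_lOp hz hσ 1), WMod.toModel_gen]
  have hinj : Function.Injective φ := by
    refine Function.Injective.of_comp_right ?_ WMod.applyPoly₂_surjective
    rw [hcomp]
    exact Model.applyPoly₂_lOp_injective hz h₀ h₁ hs
  have : Nontrivial (WMod z m₂ m₃ m₄) := by
    refine ⟨WMod.gen z m₂ m₃ m₄, 0, fun h => ?_⟩
    have h' := WMod.toModel_gen (m₂ := m₂) (m₃ := m₃) (m₄ := m₄) hz hσ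
    rw [h, map_zero] at h'
    exact zero_ne_one h'
  refine LieModule.IsIrreducible.mk fun M hM => ?_
  have hK : M.toSubmodule.map φ = ⊤ := by
    refine Model.eq_top_of_lOp_mem hz hc hS ?_ ?_
    · rintro k _ ⟨w, hw, rfl⟩
      exact ⟨_, M.lie_mem (x := lBorel k) hw, WMod.toModel_lOp hz hσ k w⟩
    · intro h
      refine hM ((LieSubmodule.toSubmodule_eq_bot M).mp
        (Submodule.map_injective_of_injective hinj ?_))
      rw [h, Submodule.map_bot]
  refine eq_top_iff.mpr fun w _ => ?_
  obtain ⟨v, hv, hvw⟩ : φ w ∈ M.toSubmodule.map φ := hK ▸ Submodule.mem_top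
  exact hinj hvw ▸ hv

end

end

end Virasoro

/-! ### The model with coefficients in `ℂ[X]` and translation by `-1` -/

theorem proposition4 (z m₂ m₃ m₄ : ℂ) (hz : z ≠ 0) (h₁ : z * m₃ ≠ m₄)
    (h₂ : (m₂, m₃, m₄) ≠ (m₂, 2 * z * m₂, 3 * z ^ 2 * m₂)) :
    LieModule.IsIrreducible ℂ Virasoro.borel (Virasoro.WMod z m₂ m₃ m₄) := by
  have hσ : taylorAlgHom (-1 : ℂ) X = X - 1 := by simp [sub_eq_add_neg]
  refine Virasoro.WMod.isIrreducible_of_model hσ (κ := fun k => lcoeff ℂ k) ?_ ?_ ?_ hz ?_ ?_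
  · simp
  · intro k
    simp [coeff_one]
  · intro k p
    simp [coeff_X_mul]
  · exact div_ne_zero (sub_ne_zero.mpr h₁.symm) (pow_ne_zero 4 hz)
  · intro J hX ha hb hne
    by_cases ha0 : Virasoro.whittakerParam₁ z m₃ m₄ = 0
    · by_cases hb0 : Virasoro.whittakerParam₂ z m₂ m₃ m₄ = 0
      -- With `a = b = 0` the parameters leave only `m₂ = c z ^ 2`, `m₃ = 2 c z ^ 3`, `m₄ = 3 c z ^
      -- 4`, which is the excluded triple.
      · refine absurd ?_ h₂
        have e2 : m₂ = Virasoro.weightParam z m₃ m₄ * z ^ 2 := by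
          rw [Virasoro.whittakerParam₂, ha0] at hb0
          linear_combination hb0
        have e3 : m₃ = 2 * z * m₂ := by
          rw [Virasoro.whittakerParam₁, sub_eq_zero, eq_div_iff (pow_ne_zero 2 hz)] at ha0
          rw [e2]
          linear_combination -ha0
        have e4 : m₄ = 3 * z ^ 2 * m₂ := by
          rw [Virasoro.weightParam] at e2
          field_simp at e2
          linear_combination -e2 + z * e3
        rw [← e3, ← e4]
      -- When only `l 2` survives, it supplies the square of the translation, a shift by `-2`.
      · refine Virasoro.Model.eq_top_of_taylor_mem hX (r := -1 + -1) (by norm_num)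
          (fun p hp => ?_) hne
        rw [← taylor_taylor]
        exact (J.smul_mem_iff hb0).mp (hb p hp)
    · exact Virasoro.Model.eq_top_of_taylor_mem hX (r := -1) (by norm_num)
        (fun p hp => (J.smul_mem_iff ha0).mp (ha p hp)) hne

end
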